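/- Let $\mathcal U,\mathcal Y$ be separable complex Hilbert spaces, let $\mathbb D$ be the open unit disk and $\mathbb T$ the unit circle, and let $S$ be in the Schur class $\mathcal S(\mathcal U,\mathcal Y)$: $S$ is analytic on $\mathbb D$ and its values are contractions from $\mathcal U$ to $\mathcal Y$. Let $T_S\colon H^2(\mathcal U)\to H^2(\mathcal Y)$, $f\mapsto S\cdot f$, be the associated analytic Toeplitz operator between the Hardy spaces of power series on $\mathbb D$ with square-summable Taylor coefficients. For an operator $P$ with $0\le P\le I$ on a Hilbert space $\mathcal H$, let $\mathcal H^l_P$ be the space $\operatorname{Ran}P^{1/2}$ with norm $\|P^{1/2}x\|_{\mathcal H^l_P}=\|Qx\|_{\mathcal H}$, where $Q$ is the orthogonal projection onto $(\operatorname{Ker}P)^\perp$. With $\mathcal H=H^2(\mathcal Y)$, the overlapping space of $T_S$ is $$\mathcal L_{T_S}=\{f\in H^2(\mathcal U)\colon T_Sf\in\mathcal H^l_{I-T_ST_S^*}\},\qquad \|f\|^2_{\mathcal L_{T_S}}=\|T_Sf\|^2_{\mathcal H^l_{I-T_ST_S^*}}+\|f\|^2_{H^2(\mathcal U)}.$$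 For almost every $\zeta\in\mathbb T$, let $S(\zeta)$ be the nontangential limit of $S$ at $\zeta$ in the weak operator topology; these limits exist almost everywhere. Then $\mathcal L_{T_S}$ is a reproducing kernel Hilbert space of $\mathcal U$-valued functions on $\mathbb D$: it is complete, and each point evaluation $f\mapsto f(w)$, $w\in\mathbb D$, is continuous from $\mathcal L_{T_S}$ to $\mathcal U$. Its reproducing kernel $K_{\mathcal L(S)}$, characterized by $K_{\mathcal L(S)}(\cdot,w)u\in\mathcal L_{T_S}$ and $\langle f,K_{\mathcal L(S)}(\cdot,w)u\rangle_{\mathcal L_{T_S}}=\langle f(w),u\rangle_{\mathcal U}$ for all $f\in\mathcal L_{T_S}$, $w\in\mathbb D$, $u\in\mathcal U$, is $$K_{\mathcal L(S)}(z,w)=\frac12\,\frac{\varphi(z)+\varphi(w)^*}{1-z\overline w}\qquad(z,w\in\mathbb D),$$ where $\varphi(z)$ is the bounded operator on $\mathcal U$ given by the (weakly convergent) integral $$\varphi(z)=\int_{\mathbb T}\frac{\zeta+z}{\zeta-z}\,\bigl(I-S(\zeta)^*S(\zeta)\bigr)\,\frac{|d\zeta|}{2\pi}.$$ -/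

import Mathlib

open scoped InnerProductSpace ComplexConjugate

namespace DeBrangesRovnyak

open Metric

set_option linter.unusedSectionVars false

/-- The `n`-th Taylor coefficient of `F` at the origin. -/
noncomputable def taylorCoeff {E : Type*} [NormedAddCommGroup E] [NormedSpace ℂ E]
    (F : ℂ → E) (n : ℕ) : E :=
  (n.factorial : ℂ)⁻¹ • iteratedDeriv n F 0

theorem circleAverage_conj_pow_smul {E : Type*} [NormedAddCommGroup E] [NormedSpace ℂ E]
    [CompleteSpace E] {F : ℂ → E} (hF : DifferentiableOn ℂ F (ball 0 1)) {r : ℝ} (hr : 0 < r)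
    (hr1 : r < 1) (m : ℕ) :
    Real.circleAverage (fun z => (conj z) ^ m • F z) 0 r =
      ((r : ℂ) ^ (2 * m)) • taylorCoeff F m := by
  have hd : DifferentiableOn ℂ F (closedBall 0 r) := hF.mono (closedBall_subset_ball hr1)
  have hc : DiffContOnCl ℂ F (ball 0 r) := by
    apply DifferentiableOn.diffContOnCl
    rwa [closure_ball _ hr.ne']
  rw [Real.circleAverage_eq_circleIntegral hr.ne']
  have h1 : (∮ z in C(0, r), (z - 0)⁻¹ • (conj z) ^ m • F z) =
      ∮ z in C(0, r), ((r : ℂ) ^ (2 * m)) • ((1 / (z - 0) ^ (m + 1)) • F z) := by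
    apply circleIntegral.integral_congr hr.le
    intro z hz
    have hz0 : ‖z‖ = r := by simpa using hz
    have hzne : z ≠ 0 := by rintro rfl; simp at hz0; exact hr.ne hz0
    have : conj z = (r : ℂ) ^ 2 / z := by
      rw [eq_div_iff hzne, mul_comm, Complex.mul_conj, Complex.normSq_eq_norm_sq, hz0]; simp
    simp only [smul_smul, this, sub_zero]
    congr 1
    rw [div_pow, ← pow_mul]
    field_simp
    ring
  rw [h1, circleIntegral.integral_smul,
    DiffContOnCl.circleIntegral_one_div_sub_center_pow_smul hr m hc, taylorCoeff,
    smul_smul, smul_smul, smul_smul]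
  congr 1
  have : (2 * (Real.pi : ℂ) * Complex.I) ≠ 0 := Complex.two_pi_I_ne_zero
  field_simp

section
variable {U Y : Type*} [NormedAddCommGroup U] [InnerProductSpace ℂ U] [CompleteSpace U]
  [NormedAddCommGroup Y] [InnerProductSpace ℂ Y] [CompleteSpace Y]

theorem circleAverage_shift {S : ℂ → U →L[ℂ] Y}
    (hS : DifferentiableOn ℂ S (ball 0 1)) {r : ℝ} (hr : 0 < r) (hr1 : r < 1) (u : U)
    (k m : ℕ) :
    Real.circleAverage (fun z => (conj z) ^ m • z ^ k • S z u) 0 r =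
      ((r : ℂ) ^ (2 * m)) • if k ≤ m then taylorCoeff S (m - k) u else 0 := by
  have hcs : ContinuousOn S (sphere 0 r) :=
    hS.continuousOn.mono (sphere_subset_closedBall.trans (closedBall_subset_ball hr1))
  have hz : ∀ z ∈ sphere (0 : ℂ) |r|, conj z * z = (r : ℂ) ^ 2 := by
    intro z hz
    rw [abs_of_pos hr, mem_sphere_zero_iff_norm] at hz
    rw [mul_comm, Complex.mul_conj, Complex.normSq_eq_norm_sq, hz]; simp
  split_ifs with hkm
  · obtain ⟨j, rfl⟩ := Nat.exists_eq_add_of_le hkm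
    have h1 := circleAverage_conj_pow_smul hS hr hr1 j
    have h2 : Set.EqOn (fun z => (conj z) ^ (k + j) • z ^ k • S z u)
        (fun z => ((r : ℂ) ^ (2 * k)) • (ContinuousLinearMap.apply ℂ Y u)
          ((conj z) ^ j • S z)) (sphere 0 |r|) := by
      intro z h
      have : (conj z) ^ (k + j) * z ^ k = (r : ℂ) ^ (2 * k) * (conj z) ^ j := by
        rw [pow_mul, ← hz z h]; ring
      simp [smul_smul, this]
    rw [Real.circleAverage_congr_sphere h2, Real.circleAverage_fun_smul]
    have h3 := ContinuousLinearMap.circleAverage_comp_comm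
      ((ContinuousLinearMap.apply ℂ Y u).restrictScalars ℝ)
      (f := fun z => (conj z) ^ j • S z) (c := 0) (R := r) (by
        apply ContinuousOn.circleIntegrable hr.le
        fun_prop)
    have h4 : (fun z => (ContinuousLinearMap.apply ℂ Y u) ((conj z) ^ j • S z)) =
      ⇑((ContinuousLinearMap.apply ℂ Y u).restrictScalars ℝ) ∘
        (fun z => (conj z) ^ j • S z) := rfl
    rw [h4, h3, h1]
    simp [smul_smul]
    congr 1
    ring
  · obtain ⟨j, rfl⟩ := Nat.exists_eq_add_of_lt (not_le.mp hkm)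
    have h2 : Set.EqOn (fun z => (conj z) ^ m • z ^ (m + j + 1) • S z u)
        (fun z => ((r : ℂ) ^ (2 * m)) • ((conj z) ^ 0 • (z ^ (j + 1) • S z u)))
          (sphere 0 |r|) := by
      intro z h
      have : (conj z) ^ m * z ^ (m + j + 1) = (r : ℂ) ^ (2 * m) * z ^ (j + 1) := by
        rw [pow_mul, ← hz z h]; ring
      simp [smul_smul, this]
    rw [Real.circleAverage_congr_sphere h2, Real.circleAverage_fun_smul,
      circleAverage_conj_pow_smul (F := fun z => z ^ (j + 1) • S z u) (by fun_prop) hr hr1]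
    simp [taylorCoeff]

theorem circleAverage_inner_poly {g : ℂ → Y} {r : ℝ} (hr : 0 < r)
    (hg : ContinuousOn g (sphere 0 r)) (b : ℕ → Y) (N : ℕ)
    (hb : ∀ m < N, Real.circleAverage (fun z => (conj z) ^ m • g z) 0 r =
      ((r : ℂ) ^ (2 * m)) • b m) :
    Real.circleAverage (fun z => ⟪∑ n ∈ Finset.range N, z ^ n • b n, g z⟫_ℂ) 0 r =
      ((∑ n ∈ Finset.range N, r ^ (2 * n) * ‖b n‖ ^ 2 : ℝ) : ℂ) := by
  have h1 : (fun z => ⟪∑ n ∈ Finset.range N, z ^ n • b n, g z⟫_ℂ) =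
      fun z => ∑ n ∈ Finset.range N, ((innerSL ℂ (b n)).restrictScalars ℝ ∘
        fun z => (conj z) ^ n • g z) z := by
    ext z
    simp [sum_inner, inner_smul_left, inner_smul_right, mul_comm]
  have hci : ∀ n, CircleIntegrable (fun z => (conj z) ^ n • g z) 0 r := by
    intro n
    apply ContinuousOn.circleIntegrable hr.le
    fun_prop
  rw [h1, Real.circleAverage_fun_sum]
  · push_cast
    refine Finset.sum_congr rfl fun n hn => ?_
    rw [ContinuousLinearMap.circleAverage_comp_comm _ (hci n), hb n (Finset.mem_range.1 hn)]
    simp [inner_smul_right, inner_self_eq_norm_sq_to_K]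
  · intro n _
    apply ContinuousOn.circleIntegrable hr.le
    exact (((innerSL ℂ (b n)).restrictScalars ℝ).continuous.comp_continuousOn (by fun_prop))

theorem circleAverage_re {F : ℂ → ℂ} {r : ℝ} (hF : CircleIntegrable F 0 r) :
    Real.circleAverage (fun z => (F z).re) 0 r = (Real.circleAverage F 0 r).re :=
  ContinuousLinearMap.circleAverage_comp_comm Complex.reCLM hF

theorem circleAverage_norm_sq_poly {r : ℝ} (hr : 0 < r) (hr1 : r < 1) (b : ℕ → Y) (N : ℕ) :
    Real.circleAverage (fun z => ‖∑ n ∈ Finset.range N, z ^ n • b n‖ ^ 2) 0 r =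
      ∑ n ∈ Finset.range N, r ^ (2 * n) * ‖b n‖ ^ 2 := by
  have hc : Continuous fun z : ℂ => ∑ n ∈ Finset.range N, z ^ n • b n := by fun_prop
  have h := circleAverage_inner_poly (g := fun z => ∑ n ∈ Finset.range N, z ^ n • b n)
    hr hc.continuousOn b N (by
      intro m hm
      simp_rw [Finset.smul_sum]
      rw [Real.circleAverage_fun_sum]
      · have h1 : ∀ n, Real.circleAverage (fun z => (conj z) ^ m • z ^ n • b n) 0 r =
          ((r : ℂ) ^ (2 * m)) • if n = m then b n else 0 := by
          intro n
          have := circleAverage_shift (S := fun _ => ContinuousLinearMap.id ℂ Y)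
            (differentiableOn_const _) hr hr1 (b n) n m
          simp only [ContinuousLinearMap.id_apply] at this
          rw [this]
          rcases lt_trichotomy n m with h | h | h
          · rw [if_pos h.le, if_neg h.ne, taylorCoeff]
            have : m - n ≠ 0 := by omega
            simp [iteratedDeriv_const, this]
          · subst h
            simp [taylorCoeff]
          · rw [if_neg (by omega), if_neg (by omega)]
        simp_rw [h1, ← Finset.smul_sum]
        simp [hm]
      · intro n _
        apply ContinuousOn.circleIntegrable hr.le
        fun_prop)
  have h2 := circleAverage_re (F := fun z => ⟪∑ n ∈ Finset.range N, z ^ n • b n,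
    ∑ n ∈ Finset.range N, z ^ n • b n⟫_ℂ) (r := r)
    (ContinuousOn.circleIntegrable hr.le (by fun_prop))
  rw [h, Complex.ofReal_re] at h2
  rw [← h2]
  congr 1
  ext z
  rw [inner_self_eq_norm_sq_to_K]
  norm_cast

theorem bessel {g : ℂ → Y} {r : ℝ} (hr : 0 < r) (hr1 : r < 1)
    (hg : ContinuousOn g (sphere 0 r)) (b : ℕ → Y) (N : ℕ)
    (hb : ∀ m < N, Real.circleAverage (fun z => (conj z) ^ m • g z) 0 r =
      ((r : ℂ) ^ (2 * m)) • b m) :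
    ∑ n ∈ Finset.range N, r ^ (2 * n) * ‖b n‖ ^ 2 ≤
      Real.circleAverage (fun z => ‖g z‖ ^ 2) 0 r := by
  have h1 := circleAverage_inner_poly hr hg b N hb
  have h2 := circleAverage_norm_sq_poly hr hr1 b N
  set q : ℂ → Y := fun z => ∑ n ∈ Finset.range N, z ^ n • b n with hq
  have hqc : ContinuousOn q (sphere 0 r) := by fun_prop
  have i1 : CircleIntegrable (fun z => ⟪q z, g z⟫_ℂ) 0 r :=
    ContinuousOn.circleIntegrable hr.le (by fun_prop)
  have i2 : CircleIntegrable (fun z => (⟪q z, g z⟫_ℂ).re) 0 r :=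
    ContinuousOn.circleIntegrable hr.le
      (Complex.continuous_re.comp_continuousOn (by fun_prop))
  have i3 : CircleIntegrable (fun z => ‖q z‖ ^ 2) 0 r :=
    ContinuousOn.circleIntegrable hr.le (by fun_prop)
  have i4 : CircleIntegrable (fun z => ‖g z‖ ^ 2) 0 r :=
    ContinuousOn.circleIntegrable hr.le (by fun_prop)
  have h3 := circleAverage_re i1
  rw [h1, Complex.ofReal_re] at h3
  have i5 : CircleIntegrable (fun z => (⟪q z, g z⟫_ℂ).re + (⟪q z, g z⟫_ℂ).re) 0 r := i2.add i2
  have i6 : CircleIntegrable (fun z => ‖g z‖ ^ 2 + ‖q z‖ ^ 2) 0 r := i4.add i3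
  have h4 := Real.circleAverage_mono i5 i6 (by
    intro z _
    have := norm_sub_sq (𝕜 := ℂ) (q z) (g z)
    have h0 := sq_nonneg ‖q z - g z‖
    simp only [RCLike.re_to_complex] at this
    linarith)
  rw [Real.circleAverage_fun_add i2 i2, Real.circleAverage_fun_add i4 i3, h2, h3] at h4
  linarith

/-- The Schur class `𝓢(U, Y)`: functions analytic on the open unit disk whose values there are
contractions from `U` to `Y`. The values of `S` off the open disk are never used. -/
structure IsSchur (S : ℂ → U →L[ℂ] Y) : Prop where
  differentiableOn : DifferentiableOn ℂ S (ball 0 1)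
  norm_le_one : ∀ z ∈ ball (0 : ℂ) 1, ‖S z‖ ≤ 1

/-- The Taylor coefficients of `z ↦ S z (f z)`, where `f z = ∑ f n * z ^ n`: the entries of the
lower triangular Toeplitz matrix built from `S`, applied to the sequence `f`. -/
noncomputable def toeplitzCoeff (S : ℂ → U →L[ℂ] Y) (f : ℕ → U) (n : ℕ) : Y :=
  ∑ k ∈ Finset.range (n + 1), taylorCoeff S (n - k) (f k)

theorem sum_norm_sq_toeplitzCoeff_le_aux {S : ℂ → U →L[ℂ] Y} (hS : IsSchur S) (f : ℕ → U)
    (N : ℕ) {r : ℝ} (hr : 0 < r) (hr1 : r < 1) :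
    ∑ n ∈ Finset.range N, r ^ (2 * n) * ‖toeplitzCoeff S f n‖ ^ 2 ≤
      ∑ n ∈ Finset.range N, r ^ (2 * n) * ‖f n‖ ^ 2 := by
  have hcs : ContinuousOn S (sphere 0 r) :=
    hS.differentiableOn.continuousOn.mono
      (sphere_subset_closedBall.trans (closedBall_subset_ball hr1))
  have hg : ContinuousOn (fun z => S z (∑ n ∈ Finset.range N, z ^ n • f n)) (sphere 0 r) :=
    hcs.clm_apply (by fun_prop)
  refine (bessel hr hr1 hg (toeplitzCoeff S f) N ?_).trans ?_
  · intro m hm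
    simp_rw [map_sum, map_smul, Finset.smul_sum]
    rw [Real.circleAverage_fun_sum]
    · simp_rw [circleAverage_shift hS.differentiableOn hr hr1]
      rw [← Finset.smul_sum, toeplitzCoeff, ← Finset.sum_filter]
      congr 2
      ext k
      simp
      omega
    · intro n _
      apply ContinuousOn.circleIntegrable hr.le
      fun_prop
  · rw [← circleAverage_norm_sq_poly hr hr1]
    apply Real.circleAverage_mono
    · exact ContinuousOn.circleIntegrable hr.le (hg.norm.pow 2)
    · exact ContinuousOn.circleIntegrable hr.le (by fun_prop)
    · intro z hz
      rw [abs_of_pos hr, mem_sphere_zero_iff_norm] at hz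
      have := (S z).le_of_opNorm_le (hS.norm_le_one z (by simpa [hz] using hr1))
        (∑ n ∈ Finset.range N, z ^ n • f n)
      rw [one_mul] at this
      gcongr

theorem sum_norm_sq_toeplitzCoeff_le {S : ℂ → U →L[ℂ] Y} (hS : IsSchur S) (f : ℕ → U)
    (N : ℕ) :
    ∑ n ∈ Finset.range N, ‖toeplitzCoeff S f n‖ ^ 2 ≤ ∑ n ∈ Finset.range N, ‖f n‖ ^ 2 := by
  have key : ∀ b : ℕ → ℝ, Filter.Tendsto
      (fun r : ℝ => ∑ n ∈ Finset.range N, r ^ (2 * n) * b n) (nhdsWithin 1 (Set.Iio 1))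
      (nhds (∑ n ∈ Finset.range N, b n)) := by
    intro b
    have : Continuous fun r : ℝ => ∑ n ∈ Finset.range N, r ^ (2 * n) * b n := by fun_prop
    simpa using (this.tendsto 1).mono_left nhdsWithin_le_nhds
  refine le_of_tendsto_of_tendsto (key _) (key _) ?_
  filter_upwards [Ioo_mem_nhdsLT (show (0 : ℝ) < 1 by norm_num)] with r hr
  exact sum_norm_sq_toeplitzCoeff_le_aux hS f N hr.1 hr.2

/-- The Hardy space `H²(U)` of `U`-valued power series on the unit disk with square-summable
Taylor coefficients; an element is recorded by its sequence of Taylor coefficients, and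
`HardySpace.eval` gives its values on the disk. -/
abbrev HardySpace (U : Type*) [NormedAddCommGroup U] [InnerProductSpace ℂ U] : Type _ :=
  lp (fun _ : ℕ => U) 2

/-- The value `f(z) = ∑ₙ fₙ zⁿ` of `f ∈ H²(U)` at a point `z` of the disk (the series converges
absolutely). -/
noncomputable def HardySpace.eval (f : HardySpace U) (z : Complex.UnitDisc) : U :=
  ∑' n : ℕ, (z : ℂ) ^ n • f n

theorem memlp_toeplitzCoeff {S : ℂ → U →L[ℂ] Y} (hS : IsSchur S) (f : HardySpace U) :
    Memℓp (toeplitzCoeff S f) 2 := by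
  refine memℓp_gen' (C := ‖f‖ ^ 2) fun s => ?_
  obtain ⟨N, hN⟩ := s.exists_nat_subset_range
  have h1 := lp.sum_rpow_le_norm_rpow (p := 2) (by norm_num) f (Finset.range N)
  simp only [ENNReal.toReal_ofNat, Real.rpow_ofNat] at h1 ⊢
  exact (Finset.sum_le_sum_of_subset_of_nonneg hN fun _ _ _ => sq_nonneg _).trans
    ((sum_norm_sq_toeplitzCoeff_le hS f N).trans h1)

/-- The analytic Toeplitz operator `T_S : H²(U) → H²(Y)`, multiplication by the Schur-class
function `S`; see `eval_toeplitz`. -/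
noncomputable def toeplitz (S : ℂ → U →L[ℂ] Y) (hS : IsSchur S) :
    HardySpace U →L[ℂ] HardySpace Y :=
  LinearMap.mkContinuous
    { toFun := fun f => ⟨toeplitzCoeff S f, memlp_toeplitzCoeff hS f⟩
      map_add' := fun f g => by
        ext n
        change toeplitzCoeff S _ n = toeplitzCoeff S f n + toeplitzCoeff S g n
        simp [toeplitzCoeff, Finset.sum_add_distrib]
      map_smul' := fun c f => by
        ext n
        change toeplitzCoeff S _ n = c • toeplitzCoeff S f n
        simp [toeplitzCoeff, Finset.smul_sum] }
    1 fun f => by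
      refine lp.norm_le_of_forall_sum_le (by norm_num) (by positivity) fun s => ?_
      obtain ⟨N, hN⟩ := s.exists_nat_subset_range
      have h1 := lp.sum_rpow_le_norm_rpow (p := 2) (by norm_num) f (Finset.range N)
      simp only [ENNReal.toReal_ofNat, Real.rpow_ofNat, one_mul] at h1 ⊢
      exact (Finset.sum_le_sum_of_subset_of_nonneg hN fun _ _ _ => sq_nonneg _).trans
        ((sum_norm_sq_toeplitzCoeff_le hS f N).trans h1)

theorem norm_toeplitz_le {S : ℂ → U →L[ℂ] Y} (hS : IsSchur S) : ‖toeplitz S hS‖ ≤ 1 :=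
  LinearMap.mkContinuous_norm_le _ zero_le_one _

theorem norm_taylorCoeff_le {S : ℂ → U →L[ℂ] Y} (hS : IsSchur S) (n : ℕ) :
    ‖taylorCoeff S n‖ ≤ 1 := by
  refine ContinuousLinearMap.opNorm_le_bound _ zero_le_one fun u => ?_
  have h := sum_norm_sq_toeplitzCoeff_le hS (Pi.single 0 u) (n + 1)
  have h1 : toeplitzCoeff S (Pi.single 0 u) n = taylorCoeff S n u := by
    rw [toeplitzCoeff, Finset.sum_eq_single 0]
    · simp
    · intro k _ hk
      simp [hk]
    · simp
  have h2 : ∑ k ∈ Finset.range (n + 1), ‖(Pi.single 0 u : ℕ → U) k‖ ^ 2 = ‖u‖ ^ 2 := by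
    rw [Finset.sum_eq_single 0]
    · simp
    · intro k _ hk
      simp [hk]
    · simp
  have h3 := Finset.single_le_sum
    (f := fun n => ‖toeplitzCoeff S (Pi.single 0 u) n‖ ^ 2) (fun _ _ => sq_nonneg _)
    (Finset.self_mem_range_succ n)
  rw [h2] at h
  simp only [h1] at h3
  rw [one_mul]
  exact le_of_sq_le_sq (h3.trans h) (norm_nonneg _)

theorem summable_hardy (f : HardySpace U) (z : Complex.UnitDisc) :
    Summable fun n : ℕ => ‖(z : ℂ) ^ n • f n‖ := by
  have hz : ‖(z : ℂ)‖ < 1 := z.norm_lt_one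
  refine Summable.of_nonneg_of_le (fun _ => norm_nonneg _) (fun n => ?_)
    ((summable_geometric_of_lt_one (norm_nonneg _) hz).mul_right ‖f‖)
  rw [norm_smul, norm_pow]
  gcongr
  exact lp.norm_apply_le_norm (by norm_num) f n

theorem tsum_toeplitzCoeff {S : ℂ → U →L[ℂ] Y} (hS : IsSchur S) (f : ℕ → U)
    (z : Complex.UnitDisc) (hs2 : Summable fun n : ℕ => ‖(z : ℂ) ^ n • f n‖) :
    ∑' n : ℕ, (z : ℂ) ^ n • toeplitzCoeff S f n = S z (∑' n : ℕ, (z : ℂ) ^ n • f n) := by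
  have hz : ‖(z : ℂ)‖ < 1 := z.norm_lt_one
  have hs1 : Summable fun n : ℕ => ‖(z : ℂ) ^ n • taylorCoeff S n‖ := by
    refine Summable.of_nonneg_of_le (fun _ => norm_nonneg _) (fun n => ?_)
      (summable_geometric_of_lt_one (norm_nonneg _) hz)
    rw [norm_smul, norm_pow]
    exact mul_le_of_le_one_right (by positivity) (norm_taylorCoeff_le hS n)
  have hS1 : HasSum (fun n : ℕ => (z : ℂ) ^ n • taylorCoeff S n) (S z) := by
    have := Complex.hasSum_taylorSeries_on_ball hS.differentiableOn
      (z := (z : ℂ)) (by simpa using hz)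
    simpa [taylorCoeff, smul_smul, mul_comm] using this
  have hprod : Summable fun p : ℕ × ℕ =>
      ((z : ℂ) ^ p.2 • taylorCoeff S p.2) ((z : ℂ) ^ p.1 • f p.1) := by
    refine Summable.of_norm_bounded (hs2.mul_of_nonneg hs1 (fun _ => norm_nonneg _)
      (fun _ => norm_nonneg _)) fun p => ?_
    rw [mul_comm]
    exact ContinuousLinearMap.le_opNorm _ _
  have h1 : ∑' p : ℕ × ℕ, ((z : ℂ) ^ p.2 • taylorCoeff S p.2) ((z : ℂ) ^ p.1 • f p.1) =
      S z (∑' n : ℕ, (z : ℂ) ^ n • f n) := by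
    have h5 : S z (∑' n : ℕ, (z : ℂ) ^ n • f n) = ∑' n : ℕ, S z ((z : ℂ) ^ n • f n) :=
      (S z).map_tsum (Summable.of_norm hs2)
    have h6 := Summable.tsum_prod hprod
    refine h6.trans (Eq.trans (tsum_congr fun k => ?_) h5.symm)
    exact (hS1.mapL (ContinuousLinearMap.apply ℂ Y ((z : ℂ) ^ k • f k))).tsum_eq
  have h7 := (Equiv.summable_iff (f := fun p : ℕ × ℕ =>
    ((z : ℂ) ^ p.2 • taylorCoeff S p.2) ((z : ℂ) ^ p.1 • f p.1))
    (Finset.HasAntidiagonal.sigmaAntidiagonalEquivProd (A := ℕ))).2 hprod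
  rw [← h1, ← Finset.HasAntidiagonal.sigmaAntidiagonalEquivProd.tsum_eq (fun p : ℕ × ℕ =>
    ((z : ℂ) ^ p.2 • taylorCoeff S p.2) ((z : ℂ) ^ p.1 • f p.1)), Summable.tsum_sigma']
  · refine tsum_congr fun n => ?_
    rw [tsum_fintype, Finset.univ_eq_attach]
    have := Finset.sum_attach (Finset.HasAntidiagonal.antidiagonal n) fun p =>
      ((z : ℂ) ^ p.2 • taylorCoeff S p.2) ((z : ℂ) ^ p.1 • f p.1)
    simp only [Finset.HasAntidiagonal.sigmaAntidiagonalEquivProd_apply]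
    rw [this, Finset.Nat.sum_antidiagonal_eq_sum_range_succ_mk]
    change (z : ℂ) ^ n • toeplitzCoeff S f n = _
    rw [toeplitzCoeff, Finset.smul_sum]
    refine Finset.sum_congr rfl fun k hk => ?_
    have : k ≤ n := Nat.lt_succ_iff.1 (Finset.mem_range.1 hk)
    simp [smul_smul, ← pow_add, this]
  · intro n
    exact (hasSum_fintype _).summable
  · exact h7

/-- `T_S` is multiplication by `S` on the disk. -/
theorem eval_toeplitz {S : ℂ → U →L[ℂ] Y} (hS : IsSchur S) (f : HardySpace U)
    (z : Complex.UnitDisc) : (toeplitz S hS f).eval z = S z (f.eval z) :=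
  tsum_toeplitzCoeff hS f z (summable_hardy f z)

end

section
variable {H K : Type*} [NormedAddCommGroup H] [InnerProductSpace ℂ H] [CompleteSpace H]
  [NormedAddCommGroup K] [InnerProductSpace ℂ K] [CompleteSpace K]

/-- The pull-back space of an operator `T`: the range of `T`, with the norm
`‖T x‖ = ‖Q x‖` where `Q` is the orthogonal projection onto `(ker T)ᗮ`; see `PullbackSpace.norm_mk`.
-/
def PullbackSpace (T : H →L[ℂ] K) : Type _ := LinearMap.range T.toLinearMap

namespace PullbackSpace
variable (T : H →L[ℂ] K)

instance : AddCommGroup (PullbackSpace T) :=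
  inferInstanceAs (AddCommGroup (LinearMap.range T.toLinearMap))

instance : Module ℂ (PullbackSpace T) :=
  inferInstanceAs (Module ℂ (LinearMap.range T.toLinearMap))

instance : CompleteSpace (LinearMap.ker T.toLinearMap) := T.isClosed_ker.completeSpace_coe

theorem ker_le : LinearMap.ker T.toLinearMap ≤ LinearMap.ker
    (LinearMap.ker T.toLinearMap)ᗮ.starProjection.toLinearMap := fun x hx => by
  simpa [Submodule.starProjection_apply_eq_zero_iff] using
    Submodule.le_orthogonal_orthogonal _ hx

/-- The linear map `T x ↦ Q x`. -/
noncomputable def lift : PullbackSpace T →ₗ[ℂ] H :=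
  (LinearMap.ker T.toLinearMap).liftQ (LinearMap.ker T.toLinearMap)ᗮ.starProjection.toLinearMap
    (ker_le T) ∘ₗ
    T.toLinearMap.quotKerEquivRange.symm.toLinearMap

/-- The element `T x` of `PullbackSpace T`. -/
def mk (x : H) : PullbackSpace T := ⟨T x, x, rfl⟩

theorem lift_mk (x : H) : lift T (mk T x) =
    (LinearMap.ker T.toLinearMap)ᗮ.starProjection x := by
  have : T.toLinearMap.quotKerEquivRange.symm ⟨T x, x, rfl⟩ =
      (LinearMap.ker T.toLinearMap).mkQ x := by
    rw [LinearEquiv.symm_apply_eq]; rfl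
  change (LinearMap.ker T.toLinearMap).liftQ _ (ker_le T)
    (T.toLinearMap.quotKerEquivRange.symm ⟨T x, x, rfl⟩) = _
  rw [this]
  simp

theorem lift_injective : Function.Injective (lift T) := by
  rw [← LinearMap.ker_eq_bot, LinearMap.ker_eq_bot']
  rintro ⟨_, x, rfl⟩ h
  rw [show lift T ⟨T.toLinearMap x, x, rfl⟩ = _ from lift_mk T x,
    Submodule.starProjection_apply_eq_zero_iff, Submodule.orthogonal_orthogonal] at h
  exact Subtype.ext h

noncomputable instance : NormedAddCommGroup (PullbackSpace T) :=
  NormedAddCommGroup.induced _ _ (lift T) (lift_injective T)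

noncomputable instance : InnerProductSpace ℂ (PullbackSpace T) :=
  InnerProductSpace.induced (lift T)

theorem norm_mk (x : H) : ‖mk T x‖ =
    ‖(LinearMap.ker T.toLinearMap)ᗮ.starProjection x‖ :=
  congrArg (fun y : H => ‖y‖) (lift_mk T x)

end PullbackSpace

/-- The lifted-norm space of a positive semidefinite contraction `P`: the range of `P ^ (1/2)`, with
the norm `‖P ^ (1/2) x‖ = ‖Q x‖` where `Q` is the orthogonal projection onto `(ker P)ᗮ`, which is
`(ker P ^ (1/2))ᗮ`. -/
noncomputable abbrev LiftedSpace (P : H →L[ℂ] H) : Type _ := PullbackSpace (CFC.sqrt P)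

variable (T : H →L[ℂ] K)

/-- The overlapping space of a contraction `T`: all `f` such that `T f` lies in the lifted-norm space
of `1 - T T*`, with `‖f‖² = ‖T f‖² + ‖f‖²`, the first norm on the right being that of the lifted-norm
space; see `OverlappingSpace.norm_sq`. -/
noncomputable def OverlappingSpace : Type _ :=
  (LinearMap.range (CFC.sqrt (1 - T ∘L T.adjoint)).toLinearMap).comap T.toLinearMap

namespace OverlappingSpace

noncomputable instance : AddCommGroup (OverlappingSpace T) :=
  inferInstanceAs (AddCommGroup
    ((LinearMap.range (CFC.sqrt (1 - T ∘L T.adjoint)).toLinearMap).comap T.toLinearMap))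

noncomputable instance : Module ℂ (OverlappingSpace T) :=
  inferInstanceAs (Module ℂ
    ((LinearMap.range (CFC.sqrt (1 - T ∘L T.adjoint)).toLinearMap).comap T.toLinearMap))

variable {T}

/-- `f` as an element of the ambient space. -/
def val (f : OverlappingSpace T) : H := f.1

/-- `T f` as an element of the lifted-norm space of `1 - T T*`. -/
noncomputable def image (f : OverlappingSpace T) : LiftedSpace (1 - T ∘L T.adjoint) := ⟨T f.1, f.2⟩

variable (T)

/-- The map `f ↦ T f ⊕ f`, whose norm is the norm of the overlapping space. -/
noncomputable def embed : OverlappingSpace T →ₗ[ℂ] WithLp 2 (LiftedSpace (1 - T ∘L T.adjoint) × H) where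
  toFun f := WithLp.toLp 2 (f.image, f.val)
  map_add' f g := by
    apply (WithLp.equiv 2 _).injective
    exact Prod.ext (Subtype.ext (map_add T f.1 g.1)) rfl
  map_smul' c f := by
    apply (WithLp.equiv 2 _).injective
    exact Prod.ext (Subtype.ext (map_smul T c f.1)) rfl

theorem embed_injective : Function.Injective (embed T) := fun _ _ h =>
  Subtype.ext (congrArg (fun x => (WithLp.ofLp x).2) h)

noncomputable instance : NormedAddCommGroup (OverlappingSpace T) :=
  NormedAddCommGroup.induced _ _ (embed T) (embed_injective T)

noncomputable instance : InnerProductSpace ℂ (OverlappingSpace T) :=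
  InnerProductSpace.induced (embed T)

theorem norm_sq (f : OverlappingSpace T) : ‖f‖ ^ 2 = ‖f.image‖ ^ 2 + ‖f.val‖ ^ 2 :=
  WithLp.prod_norm_sq_eq_of_L2 (embed T f)

end OverlappingSpace
end

section
variable {U Y : Type*} [NormedAddCommGroup U] [InnerProductSpace ℂ U] [CompleteSpace U]
  [NormedAddCommGroup Y] [InnerProductSpace ℂ Y] [CompleteSpace Y]

/-- `A` is the nontangential limit of `S` at the point `ζ` of the unit circle, in the weak operator
topology: the limit exists within each nontangential approach region at `ζ`. -/
def HasNontangentialLimit (S : ℂ → U →L[ℂ] Y) (ζ : ℂ) (A : U →L[ℂ] Y) : Prop :=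
  ∀ M : ℝ, 1 < M → ∀ (u : U) (y : Y),
    Filter.Tendsto (fun z => ⟪y, S z u⟫_ℂ)
      (nhdsWithin ζ {z : ℂ | ‖z‖ < 1 ∧ ‖z - ζ‖ < M * (1 - ‖z‖)}) (nhds ⟪y, A u⟫_ℂ)

/-- `B` is a boundary value function of `S`: at almost every point `ζ` of the unit circle, `B ζ` is
the weak nontangential limit of `S`. -/
def IsBoundaryFunction (S B : ℂ → U →L[ℂ] Y) : Prop :=
  ∀ᵐ t : ℝ, HasNontangentialLimit S (circleMap 0 1 t) (B (circleMap 0 1 t))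

/-- `A` is the integral of the operator-valued function `F` over the unit circle with respect to
normalized arc length, in the weak sense. -/
def HasWeakCircleAverage (F : ℂ → U →L[ℂ] U) (A : U →L[ℂ] U) : Prop :=
  ∀ u v : U, CircleIntegrable (fun ζ => ⟪v, F ζ u⟫_ℂ) 0 1 ∧
    Real.circleAverage (fun ζ => ⟪v, F ζ u⟫_ℂ) 0 1 = ⟪v, A u⟫_ℂ

/-- `φ` is the Herglotz integral of `1 - B* B`. -/
def IsHerglotzIntegral (B : ℂ → U →L[ℂ] Y) (φ : Complex.UnitDisc → U →L[ℂ] U) : Prop :=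
  ∀ z : Complex.UnitDisc, HasWeakCircleAverage
    (fun ζ => ((ζ + z) / (ζ - z)) • (1 - (B ζ).adjoint ∘L B ζ)) (φ z)

end

end DeBrangesRovnyak

open DeBrangesRovnyak

/-! Write `T` for the Toeplitz operator `T_S`, `D` for `(1 - T T*)^(1/2)` and `k_w u` for the Szegő
function `(1 - w̄ζ)⁻¹ u`, which represents evaluation at `w` in `H²(U)`. The norm of the overlapping
space makes `f` isometric to the pair `(a, f)` with `a ⊥ ker D` and `D a = T f`. These pairs form a
closed subspace of a Hilbert space, so the overlapping space is complete
(`OverlappingSpace.range_isometry`). The inclusion in `H²(U)` is a contraction, so point evaluations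
are continuous.

Since `(1 - T T*) T = T (1 - T* T)`, every `(1 - T* T) h` lies in the overlapping space, and pairing
with it there is pairing with `h` in `H²(U)` (`OverlappingSpace.inner_defect`). Hence the kernel
function at `w` in the direction `u` is `(1 - T* T) k_w u`, and `⟪v, K(z,w) u⟫ = ⟪k_z v, k_w u⟫ - ⟪T
k_z v, T k_w u⟫`.

Both inner products are boundary integrals by Parseval's identity (`circleAverage_inner_boundary`),
since `T k_w u` has the boundary values `(1 - w̄ζ)⁻¹ B(ζ) u`. Their difference is the integral of
the product of two scalar Szegő kernels with the form of `1 - B* B`. On the unit circle that product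
is half of `(1 - z w̄)⁻¹` times the sum of the Herglotz kernel at `z` and the conjugate of the one
at `w` (`szego_mul_eq_herglotz`). Integration gives `φ(z) + φ(w)*`.

The boundary values come from Fatou's theorem. A primitive of a bounded analytic function is
Lipschitz, hence differentiable along the circle almost everywhere; a Lindelöf-type maximum
principle carries the first-order expansion into the disk, and Cauchy's estimate differentiates it.
Separability reduces the operator case to countably many scalar functions. -/

namespace DeBrangesRovnyak

open Metric Filter Topology Asymptotics MeasureTheory

set_option linter.unusedSectionVars false

/-! ### Fatou's theorem for scalar functions -/

/-- The maximum principle for a bounded function that is continuous up to the circle except at one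
point. -/
theorem norm_le_of_norm_le_sphere_of_bounded {Q : ℂ → ℂ} {ζ : ℂ} (hζ : ‖ζ‖ = 1) {C ε : ℝ}
    (hε : 0 < ε) (hd : DifferentiableOn ℂ Q (ball 0 1))
    (hc : ∀ z ∈ closedBall (0 : ℂ) 1, z ≠ ζ → ContinuousWithinAt Q (closedBall 0 1) z)
    (hC : ∀ z ∈ closedBall (0 : ℂ) 1, ‖Q z‖ ≤ C) (hs : ∀ z ∈ sphere (0 : ℂ) 1, ‖Q z‖ ≤ ε)
    {z : ℂ} (hz : z ∈ ball (0 : ℂ) 1) : ‖Q z‖ ≤ ε := by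
  have hz1 : ‖z‖ < 1 := by simpa using hz
  have hzζ : z ≠ ζ := by rintro rfl; linarith
  have hzp : 0 < ‖z - ζ‖ := norm_pos_iff.2 (sub_ne_zero.2 hzζ)
  -- The factor `z - ζ` restores continuity at `ζ`. Applying the maximum principle to `Q ^ n * (z -
  -- ζ)` and letting `n` grow makes the cost of that factor disappear.
  have hpow : ∀ n : ℕ, (‖Q z‖ / ε) ^ n ≤ 2 / ‖z - ζ‖ := by
    intro n
    have hGd : DiffContOnCl ℂ (fun z => Q z ^ n * (z - ζ)) (ball 0 1) := by
      refine ⟨(hd.pow n).mul (by fun_prop), ?_⟩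
      rw [closure_ball _ one_ne_zero]
      intro x hx
      by_cases hxζ : x = ζ
      · subst hxζ
        rw [ContinuousWithinAt, sub_self, mul_zero]
        refine squeeze_zero_norm' (a := fun z => C ^ n * ‖z - x‖) ?_ ?_
        · filter_upwards [self_mem_nhdsWithin] with y hy
          rw [norm_mul, norm_pow]
          gcongr
          exact hC y hy
        · have : Continuous fun z : ℂ => C ^ n * ‖z - x‖ := by fun_prop
          simpa using (this.tendsto x).mono_left nhdsWithin_le_nhds
      · exact ((hc x hx hxζ).pow n).mul (by fun_prop)
    have hGb := Complex.norm_le_of_forall_mem_frontier_norm_le isBounded_ball hGd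
      (C := ε ^ n * 2) (by
        intro x hx
        rw [frontier_ball _ one_ne_zero] at hx
        rw [norm_mul, norm_pow]
        gcongr
        · exact hs x hx
        · refine (norm_sub_le _ _).trans ?_
          rw [mem_sphere_zero_iff_norm.1 hx, hζ]; norm_num) (subset_closure hz)
    rw [norm_mul, norm_pow] at hGb
    rw [le_div_iff₀ hzp, div_pow, div_mul_eq_mul_div, div_le_iff₀ (by positivity), mul_comm 2]
    exact hGb
  have hle : ‖Q z‖ / ε ≤ 1 := by
    by_contra! h
    obtain ⟨n, hn⟩ := pow_unbounded_of_one_lt (2 / ‖z - ζ‖) h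
    exact absurd (hpow n) (not_le.2 hn)
  rwa [div_le_one hε] at hle

/-- An analytic function of modulus at least one on the disk, equal to one at a given boundary point
and large away from it. -/
theorem exists_peak {ζ : ℂ} (hζ : ‖ζ‖ = 1) {η R : ℝ} (hη : 0 < η) (hR : 0 ≤ R) :
    ∃ D : ℂ → ℂ, Differentiable ℂ D ∧ D ζ = 1 ∧ (∀ z, ‖z‖ ≤ 1 → 1 ≤ ‖D z‖) ∧
      ∀ z, η ≤ ‖z - ζ‖ → R ≤ ‖D z‖ := by
  have hconj : ζ * conj ζ = 1 := by
    rw [Complex.mul_conj, Complex.normSq_eq_norm_sq, hζ]; simp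
  obtain ⟨N, hN0, hN⟩ : ∃ N : ℝ, 0 ≤ N ∧ N * η = R + 1 :=
    ⟨(R + 1) / η, by positivity, by field_simp⟩
  -- `1 - z ζ̄` has nonnegative real part on the closed disk and modulus `‖z - ζ‖`. The choice `N η
  -- = R + 1` leaves `R` after the summand `1` is subtracted.
  refine ⟨fun z => 1 + N * (1 - z * conj ζ), by fun_prop, by simp [hconj], ?_, ?_⟩
  · intro z hz
    have h1 : (z * conj ζ).re ≤ 1 := by
      refine (Complex.re_le_norm _).trans ?_
      simpa [hζ] using hz
    have h2 : (1 + N * (1 - z * conj ζ) : ℂ).re = 1 + N * (1 - (z * conj ζ).re) := by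
      simp [Complex.mul_re]
    refine le_trans ?_ (Complex.re_le_norm _)
    rw [h2]
    nlinarith [mul_nonneg hN0 (sub_nonneg.2 h1)]
  · intro z hz
    have h1 : (1 : ℂ) - z * conj ζ = (ζ - z) * conj ζ := by rw [sub_mul, hconj]
    have h2 : ‖(N : ℂ) * (1 - z * conj ζ)‖ = N * ‖z - ζ‖ := by
      rw [h1, norm_mul, norm_mul, RCLike.norm_conj, hζ, mul_one, norm_sub_rev]
      simp [abs_of_nonneg hN0]
    have h3 := norm_sub_norm_le ((N : ℂ) * (1 - z * conj ζ)) (-1)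
    rw [h2, norm_neg, norm_one, sub_neg_eq_add, add_comm] at h3
    have h4 := mul_le_mul_of_nonneg_left hz hN0
    change R ≤ ‖1 + (N : ℂ) * (1 - z * conj ζ)‖
    linarith

/-- A maximum principle of Lindelöf type: a bound `o(z - ζ)` at a boundary point of the disk passes
from the circle to the disk. -/
theorem isLittleO_ball_of_isLittleO_sphere {K : ℂ → ℂ} {ζ : ℂ} (hζ : ‖ζ‖ = 1) {C : ℝ}
    (hK : DiffContOnCl ℂ K (ball 0 1)) (hC : ∀ z, ‖K z‖ ≤ C * ‖z - ζ‖)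
    (hs : K =o[𝓝[sphere 0 1] ζ] fun z => z - ζ) :
    K =o[𝓝[ball 0 1] ζ] fun z => z - ζ := by
  have hC0 : 0 ≤ C := by
    have h0 := hC 0
    rw [zero_sub, norm_neg, hζ, mul_one] at h0
    exact (norm_nonneg _).trans h0
  rw [isLittleO_iff]
  intro c hc
  obtain ⟨ε, hε0, hε⟩ : ∃ ε : ℝ, 0 < ε ∧ ε * 2 = c := ⟨c / 2, by positivity, by ring⟩
  obtain ⟨η, hη, hηs⟩ := Metric.mem_nhdsWithin_iff.1 (hs.def hε0)
  -- Near `ζ` the bound `ε ‖z - ζ‖` on the circle is the hypothesis; farther away `‖D‖ ≥ C / ε`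
  -- turns the crude bound `C ‖z - ζ‖` into `ε ‖D‖ ‖z - ζ‖`.
  obtain ⟨D, hDd, hDζ, hD1, hD2⟩ := exists_peak hζ hη (R := C / ε) (by positivity)
  have hDc := hDd.continuous
  have hDne : ∀ z, ‖z‖ ≤ 1 → D z ≠ 0 := fun z hz h => by
    have := hD1 z hz
    rw [h, norm_zero] at this
    linarith
  have hKD : ∀ z, ‖z‖ = 1 → ‖K z‖ ≤ ε * ‖D z‖ * ‖z - ζ‖ := by
    intro z hz
    by_cases hzη : z ∈ ball ζ η
    · refine (hηs ⟨hzη, by simpa using hz⟩ : ‖K z‖ ≤ ε * ‖z - ζ‖).trans ?_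
      gcongr
      exact le_mul_of_one_le_right hε0.le (hD1 z hz.le)
    · refine (hC z).trans ?_
      gcongr
      rw [mem_ball, dist_eq_norm, not_lt] at hzη
      have h2 := hD2 z hzη
      rwa [div_le_iff₀ hε0, mul_comm] at h2
  have key : ∀ z ∈ ball (0 : ℂ) 1, ‖K z‖ ≤ ε * ‖D z‖ * ‖z - ζ‖ := by
    intro z hz
    have hz1 : ‖z‖ < 1 := by simpa using hz
    have hzζ : z ≠ ζ := by rintro rfl; linarith
    have hzp : 0 < ‖z - ζ‖ := norm_pos_iff.2 (sub_ne_zero.2 hzζ)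
    have hDp : 0 < ‖D z‖ := zero_lt_one.trans_le (hD1 z hz1.le)
    -- At `ζ` the quotient has the value `0`, by division by zero, so the bounds on the closed disk
    -- and on the circle hold there too.
    have hQ := norm_le_of_norm_le_sphere_of_bounded (Q := fun z => K z / (z - ζ) / D z) hζ hε0
      (C := C) (fun x hx => ?_) (fun x hx hxζ => ?_) (fun x hx => ?_) (fun x hx => ?_) hz
    · rw [norm_div, norm_div, div_le_iff₀ hDp, div_le_iff₀ hzp] at hQ
      exact hQ
    · have hx1 : ‖x‖ < 1 := by simpa using hx
      have hxζ : x - ζ ≠ 0 := sub_ne_zero.2 (by rintro rfl; linarith)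
      have h1 := hK.1 x hx
      have h2 := hDd.differentiableAt.differentiableWithinAt (x := x) (s := ball 0 1)
      have h3 := hDne x hx1.le
      fun_prop (disch := assumption)
    · have hKc := hK.2
      rw [closure_ball _ one_ne_zero] at hKc
      have h1 := hKc x hx
      have h2 := hDne x (by simpa using hx)
      have h3 : ContinuousWithinAt (fun z => z - ζ) (closedBall 0 1) x := by fun_prop
      have h4 : ContinuousWithinAt (fun z => K z / (z - ζ)) (closedBall 0 1) x :=
        h1.div h3 (sub_ne_zero.2 hxζ)
      exact h4.div hDc.continuousWithinAt h2
    · have hx1 : ‖x‖ ≤ 1 := by simpa using hx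
      rw [norm_div, norm_div, div_le_iff₀ (zero_lt_one.trans_le (hD1 x hx1))]
      exact (div_le_of_le_mul₀ (norm_nonneg _) hC0 (hC x)).trans
        (le_mul_of_one_le_right hC0 (hD1 x hx1))
    · have hx1 : ‖x‖ = 1 := by simpa using hx
      rw [norm_div, norm_div, div_le_iff₀ (zero_lt_one.trans_le (hD1 x hx1.le))]
      exact div_le_of_le_mul₀ (norm_nonneg _) (by positivity) (hKD x hx1)
  have hDnear : ∀ᶠ z in 𝓝[ball 0 1] ζ, ‖D z‖ < 2 := by
    refine nhdsWithin_le_nhds ?_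
    refine hDc.norm.continuousAt.eventually_lt continuousAt_const ?_
    simp [hDζ]
  filter_upwards [self_mem_nhdsWithin, hDnear] with z hz hz2
  refine (key z hz).trans ?_
  have : ε * ‖D z‖ ≤ c := by rw [← hε]; gcongr
  gcongr

/-- Along the unit circle, differentiability in the angle is differentiability in the point. -/
theorem isLittleO_sphere_of_hasDerivAt_circleMap {g : ℂ → ℂ} {t : ℝ} {d : ℂ}
    (hd : HasDerivAt (fun s : ℝ => g (circleMap 0 1 s)) d t) :
    (fun z => g z - g (circleMap 0 1 t) -
      (-Complex.I * d / circleMap 0 1 t) * (z - circleMap 0 1 t))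
      =o[𝓝[sphere 0 1] (circleMap 0 1 t)] fun z => z - circleMap 0 1 t := by
  set ζ := circleMap 0 1 t with hζdef
  have hζ : ‖ζ‖ = 1 := by simp [hζdef]
  have hζ0 : ζ ≠ 0 := by intro h; simp [h] at hζ
  -- On the circle `log (z / ζ)` is `i` times the angle from `ζ` to `z`, and it is complex
  -- differentiable at `ζ`; this converts increments of the angle into increments of `z`.
  have hlog : HasDerivAt (fun z : ℂ => Complex.log (z / ζ)) (1 / ζ) ζ := by
    have h1 : HasDerivAt (fun z : ℂ => z / ζ) (1 / ζ) ζ := (hasDerivAt_id ζ).div_const ζ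
    have := h1.clog (by rw [div_self hζ0]; exact Complex.one_mem_slitPlane)
    simpa [div_self hζ0] using this
  have hang : Tendsto (fun z : ℂ => t + Complex.arg (z / ζ)) (𝓝[sphere 0 1] ζ) (𝓝 t) := by
    have h1 : ContinuousAt (fun z : ℂ => t + Complex.arg (z / ζ)) ζ := by
      have h0 : ContinuousAt Complex.arg (ζ / ζ) := by
        rw [div_self hζ0]
        exact Complex.continuousAt_arg Complex.one_mem_slitPlane
      exact continuousAt_const.add
        (ContinuousAt.comp (f := fun z : ℂ => z / ζ) (x := ζ) h0 (by fun_prop))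
    have h2 := h1.tendsto
    rw [div_self hζ0, Complex.arg_one, add_zero] at h2
    exact h2.mono_left nhdsWithin_le_nhds
  have hsph : ∀ z ∈ sphere (0 : ℂ) 1, circleMap 0 1 (t + Complex.arg (z / ζ)) = z ∧
      Complex.log (z / ζ) = Complex.arg (z / ζ) * Complex.I := by
    intro z hz
    have hz1 : ‖z / ζ‖ = 1 := by rw [norm_div, hζ, mem_sphere_zero_iff_norm.1 hz, div_one]
    constructor
    · have h1 := Complex.norm_mul_exp_arg_mul_I (z / ζ)
      rw [hz1, Complex.ofReal_one, one_mul] at h1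
      simp only [circleMap, Complex.ofReal_add, add_mul, Complex.exp_add, h1]
      have : ζ = Complex.exp (t * Complex.I) := by simp [hζdef, circleMap]
      rw [← this]
      simp
      field_simp
    · rw [Complex.log, hz1]; simp
  have h1 := (hasDerivAt_iff_isLittleO.1 hd).comp_tendsto hang
  have h2 := (hasDerivAt_iff_isLittleO.1 hlog).mono (nhdsWithin_le_nhds (s := sphere 0 1))
  have h3 : (fun z : ℂ => ((t + Complex.arg (z / ζ) - t : ℝ))) =O[𝓝[sphere 0 1] ζ]
      fun z => z - ζ := by
    have h4 := hlog.isBigO_sub.mono (nhdsWithin_le_nhds (s := sphere 0 1))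
    refine IsBigO.congr' (IsBigO.norm_left h4) ?_ EventuallyEq.rfl |>.of_norm_left
    filter_upwards [self_mem_nhdsWithin] with z hz
    rw [div_self hζ0, Complex.log_one, sub_zero, (hsph z hz).2]
    simp
  have h5 := (h1.trans_isBigO h3).add (h2.const_mul_left (-Complex.I * d))
  refine h5.congr' ?_ EventuallyEq.rfl
  filter_upwards [self_mem_nhdsWithin] with z hz
  simp only [Function.comp, (hsph z hz).1]
  rw [div_self hζ0, Complex.log_one, (hsph z hz).2, ← hζdef]
  simp only [smul_eq_mul, Complex.real_smul]
  push_cast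
  linear_combination (-d * (Complex.arg (z / ζ) : ℂ)) * Complex.I_sq

/-- Fatou's theorem: a bounded analytic function on the disk has nontangential limits almost
everywhere on the circle. -/
theorem ae_exists_nontangential_limit {f : ℂ → ℂ} (hf : DifferentiableOn ℂ f (ball 0 1)) {C : ℝ}
    (hC : ∀ z ∈ ball (0 : ℂ) 1, ‖f z‖ ≤ C) :
    ∀ᵐ t : ℝ, ∃ a : ℂ, ∀ M : ℝ, 1 < M → Tendsto f (𝓝[{z : ℂ | ‖z‖ < 1 ∧
      ‖z - circleMap 0 1 t‖ < M * (1 - ‖z‖)}] (circleMap 0 1 t)) (𝓝 a) := by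
  have hC0 : 0 ≤ C := (norm_nonneg _).trans (hC 0 (by simp))
  -- Passing to a primitive trades boundary limits of `f` for derivatives of a Lipschitz function,
  -- which exist almost everywhere on the circle.
  obtain ⟨F, hF⟩ := hf.isExactOn_ball
  have hFlip : LipschitzOnWith ⟨C, hC0⟩ F (ball 0 1) :=
    (convex_ball 0 1).lipschitzOnWith_of_nnnorm_hasDerivWithin_le
      (fun z hz => (hF z hz).hasDerivWithinAt) (fun z hz => hC z hz)
  obtain ⟨g, hg, hgF⟩ := hFlip.extend_finite_dimension
  set L := lipschitzExtensionConstant ℂ * ⟨C, hC0⟩ with hL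
  have hgd : ∀ z ∈ ball (0 : ℂ) 1, HasDerivAt g (f z) z := fun z hz =>
    (hF z hz).congr_of_eventuallyEq (hgF.symm.eventuallyEq_of_mem (isOpen_ball.mem_nhds hz))
  have hlip : LipschitzWith (L * _) fun s : ℝ => g (circleMap 0 1 s) :=
    hg.comp (lipschitzWith_circleMap 0 1)
  filter_upwards [hlip.ae_differentiableAt_real] with t ht
  set ζ := circleMap 0 1 t with hζdef
  have hζ : ‖ζ‖ = 1 := by simp [hζdef]
  set d := deriv (fun s : ℝ => g (circleMap 0 1 s)) t
  -- Chain rule: the derivative of `s ↦ circleMap 0 1 s` at `t` is `i ζ`, so the slope in `z` is `d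
  -- / (i ζ)`.
  set a := -Complex.I * d / ζ with ha
  refine ⟨a, fun M hM => ?_⟩
  set K : ℂ → ℂ := fun z => g z - g ζ - a * (z - ζ) with hK
  have hKd : DiffContOnCl ℂ K (ball 0 1) := by
    have h1 : DiffContOnCl ℂ g (ball 0 1) :=
      ⟨fun z hz => (hgd z hz).differentiableAt.differentiableWithinAt, hg.continuous.continuousOn⟩
    exact (h1.sub_const _).sub (Differentiable.diffContOnCl (by fun_prop))
  have hKo : K =o[𝓝[ball 0 1] ζ] fun z => z - ζ := by
    refine isLittleO_ball_of_isLittleO_sphere hζ hKd (C := L + ‖a‖) (fun z => ?_)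
      (isLittleO_sphere_of_hasDerivAt_circleMap ht.hasDerivAt)
    rw [add_mul]
    refine (norm_sub_le _ _).trans (add_le_add ?_ (norm_mul _ _).le)
    simpa [dist_eq_norm] using hg.dist_le_mul z ζ
  rw [Metric.tendsto_nhds]
  intro ε hε
  have hM0 : 0 < 2 * M + 1 := by linarith
  obtain ⟨η, hη, hηs⟩ := Metric.mem_nhdsWithin_iff.1
    (hKo.def (show 0 < ε / (2 * (2 * M + 1)) by positivity))
  refine Metric.mem_nhdsWithin_iff.2 ⟨η / 2, by positivity, fun z ⟨hzη, hz⟩ => ?_⟩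
  rw [mem_ball, dist_eq_norm] at hzη
  obtain ⟨hz1, hzM⟩ := hz
  -- The disk of radius `ρ` about `z` stays inside the unit disk, and in the approach region its
  -- points lie within `(2 M + 1) ρ` of `ζ`. The `o(z - ζ)` bound on `K` is therefore `o(ρ)`, which
  -- Cauchy's estimate for `K' = f - a` needs.
  set ρ := (1 - ‖z‖) / 2 with hρ
  have hρ0 : 0 < ρ := by rw [hρ]; linarith
  have hzρ : 1 - ‖z‖ ≤ ‖z - ζ‖ := by
    have := norm_sub_norm_le ζ z
    rw [hζ, norm_sub_rev] at this
    exact this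
  have hsub : closedBall z ρ ⊆ ball 0 1 := by
    intro x hx
    rw [mem_closedBall, dist_eq_norm] at hx
    rw [mem_ball_zero_iff]
    have := norm_sub_norm_le x z
    linarith
  have hder : deriv K z = f z - a := by
    have h1 := ((hgd z (by simpa using hz1)).sub_const (g ζ)).sub
      (((hasDerivAt_id z).sub_const ζ).const_mul a)
    rw [mul_one] at h1
    exact h1.deriv
  have hest := Complex.norm_deriv_le_of_forall_mem_sphere_norm_le (f := K) hρ0
    (hKd.mono (ball_subset_closedBall.trans hsub)) (C := ε / 2 * ρ) (by
      intro x hx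
      have hxb : x ∈ ball (0 : ℂ) 1 := hsub (sphere_subset_closedBall hx)
      rw [mem_sphere, dist_eq_norm] at hx
      have h1 : ‖x - ζ‖ ≤ ρ + ‖z - ζ‖ := by
        rw [← hx]; exact norm_sub_le_norm_sub_add_norm_sub x z ζ
      have h2 : x ∈ ball ζ η := by
        rw [mem_ball, dist_eq_norm]
        linarith
      refine (hηs ⟨h2, hxb⟩ : ‖K x‖ ≤ _ * ‖x - ζ‖).trans ?_
      have h3 : ‖x - ζ‖ ≤ (2 * M + 1) * ρ := by
        have : 1 - ‖z‖ = 2 * ρ := by rw [hρ]; ring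
        rw [this] at hzM
        linarith
      refine (mul_le_mul_of_nonneg_left h3 (by positivity)).trans (le_of_eq ?_)
      field_simp)
  rw [hder, mul_div_assoc, div_self hρ0.ne', mul_one] at hest
  change dist (f z) a < ε
  rw [dist_eq_norm]
  linarith

/-! ### Weak operator limits and boundary values of Schur functions -/

section
variable {U Y : Type*} [NormedAddCommGroup U] [InnerProductSpace ℂ U] [CompleteSpace U]
  [NormedAddCommGroup Y] [InnerProductSpace ℂ Y] [CompleteSpace Y]

/-- A bounded sesquilinear form is given by a bounded operator. -/
theorem exists_clm_inner_eq {φ : Y → U → ℂ} {C : ℝ} (hC : 0 ≤ C)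
    (hadd : ∀ y y' u, φ (y + y') u = φ y u + φ y' u)
    (hsmul : ∀ (c : ℂ) y u, φ (c • y) u = conj c * φ y u)
    (hadd' : ∀ y u u', φ y (u + u') = φ y u + φ y u')
    (hsmul' : ∀ (c : ℂ) y u, φ y (c • u) = c * φ y u)
    (hb : ∀ y u, ‖φ y u‖ ≤ C * ‖u‖ * ‖y‖) :
    ∃ A : U →L[ℂ] Y, ∀ y u, ⟪y, A u⟫_ℂ = φ y u := by
  -- Riesz representation in `y` for fixed `u`; the conjugate makes the functional linear in `y`.
  let ℓ : U → StrongDual ℂ Y := fun u => LinearMap.mkContinuous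
    { toFun := fun y => conj (φ y u)
      map_add' := fun y y' => by rw [hadd, map_add]
      map_smul' := fun c y => by simp [hsmul] } (C * ‖u‖) fun y => by
        simpa using hb y u
  have hℓ : ∀ y u, ⟪y, (InnerProductSpace.toDual ℂ Y).symm (ℓ u)⟫_ℂ = φ y u := by
    intro y u
    rw [← inner_conj_symm, InnerProductSpace.toDual_symm_apply]
    exact Complex.conj_conj _
  refine ⟨LinearMap.mkContinuous
    { toFun := fun u => (InnerProductSpace.toDual ℂ Y).symm (ℓ u)
      map_add' := fun u u' => ext_inner_left ℂ fun y => by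
        rw [inner_add_right, hℓ, hℓ, hℓ, hadd']
      map_smul' := fun c u => ext_inner_left ℂ fun y => by
        rw [inner_smul_right, hℓ, hℓ, hsmul', RingHom.id_apply] } C fun u => ?_, hℓ⟩
  change ‖(InnerProductSpace.toDual ℂ Y).symm (ℓ u)‖ ≤ _
  rw [LinearIsometryEquiv.norm_map]
  exact LinearMap.mkContinuous_norm_le _ (by positivity) _

theorem norm_inner_clm_le {A : U →L[ℂ] Y} (hA : ‖A‖ ≤ 1) (y : Y) (u : U) :
    ‖⟪y, A u⟫_ℂ‖ ≤ ‖u‖ * ‖y‖ := by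
  refine (norm_inner_le_norm y (A u)).trans ?_
  rw [mul_comm]
  gcongr
  simpa using A.le_of_opNorm_le hA u

/-- Testing the weak limit against `y = A u` gives `‖A u‖² ≤ ‖u‖ ‖A u‖`. -/
theorem norm_le_one_of_tendsto {X : Type*} {l : Filter X} [l.NeBot] {S : X → U →L[ℂ] Y}
    (hS : ∀ᶠ z in l, ‖S z‖ ≤ 1) {A : U →L[ℂ] Y}
    (hA : ∀ u y, Tendsto (fun z => ⟪y, S z u⟫_ℂ) l (𝓝 ⟪y, A u⟫_ℂ)) : ‖A‖ ≤ 1 := by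
  refine A.opNorm_le_bound zero_le_one fun u => ?_
  have h := le_of_tendsto (hA u (A u)).norm (hS.mono fun z hz => norm_inner_clm_le hz (A u) u)
  rw [inner_self_eq_norm_sq_to_K, norm_pow, RCLike.norm_ofReal, abs_norm, sq] at h
  rw [one_mul]
  rcases (norm_nonneg (A u)).eq_or_lt with h0 | h0
  · rw [← h0]; exact norm_nonneg u
  · exact le_of_mul_le_mul_right h h0

/-- Weak operator compactness of the unit ball. -/
theorem exists_tendsto_ultrafilter {X : Type*} (𝒰 : Ultrafilter X) {S : X → U →L[ℂ] Y}
    (hS : ∀ᶠ z in (𝒰 : Filter X), ‖S z‖ ≤ 1) :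
    ∃ A : U →L[ℂ] Y, ∀ u y, Tendsto (fun z => ⟪y, S z u⟫_ℂ) 𝒰 (𝓝 ⟪y, A u⟫_ℂ) := by
  have hex : ∀ y u, ∃ L : ℂ, Tendsto (fun z => ⟪y, S z u⟫_ℂ) 𝒰 (𝓝 L) := by
    intro y u
    obtain ⟨L, -, hL⟩ := (isCompact_closedBall (0 : ℂ) (‖u‖ * ‖y‖)).ultrafilter_le_nhds
      (𝒰.map fun z => ⟪y, S z u⟫_ℂ) (by
        rw [le_principal_iff]
        change ∀ᶠ z in (𝒰 : Filter X), ⟪y, S z u⟫_ℂ ∈ closedBall (0 : ℂ) (‖u‖ * ‖y‖)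
        filter_upwards [hS] with z hz
        simpa using norm_inner_clm_le hz y u)
    exact ⟨L, hL⟩
  choose φ hφ using hex
  obtain ⟨A, hA⟩ := exists_clm_inner_eq (φ := φ) zero_le_one
    (fun y y' u => tendsto_nhds_unique (hφ _ _) (by
      simpa only [inner_add_left] using (hφ y u).add (hφ y' u)))
    (fun c y u => tendsto_nhds_unique (hφ _ _) (by
      simpa only [inner_smul_left] using (hφ y u).const_mul (conj c)))
    (fun y u u' => tendsto_nhds_unique (hφ _ _) (by
      simpa only [map_add, inner_add_right] using (hφ y u).add (hφ y u')))
    (fun c y u => tendsto_nhds_unique (hφ _ _) (by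
      simpa only [map_smul, inner_smul_right] using (hφ y u).const_mul c))
    (fun y u => by
      rw [one_mul]
      exact le_of_tendsto (hφ y u).norm (hS.mono fun z hz => norm_inner_clm_le hz y u))
  exact ⟨A, fun u y => by rw [hA]; exact hφ y u⟩

/-- Weak limits of contractions exist as soon as they exist on dense sets. -/
theorem exists_weak_limit_of_dense {X ι κ : Type*} {l : Filter X} [l.NeBot] {S : X → U →L[ℂ] Y}
    (hS : ∀ᶠ z in l, ‖S z‖ ≤ 1) {a : ι → U} {b : κ → Y} (ha : DenseRange a) (hb : DenseRange b)
    (h : ∀ i j, ∃ L : ℂ, Tendsto (fun z => ⟪b j, S z (a i)⟫_ℂ) l (𝓝 L)) :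
    ∃ A : U →L[ℂ] Y, ∀ u y, Tendsto (fun z => ⟪y, S z u⟫_ℂ) l (𝓝 ⟪y, A u⟫_ℂ) := by
  have h𝒰 : (Ultrafilter.of l : Filter X) ≤ l := Ultrafilter.of_le l
  -- An ultrafilter finer than `l` supplies the candidate limit. On the dense sets it must agree
  -- with the limits along `l`, and the uniform norm bound extends this to all vectors.
  obtain ⟨A, hA⟩ := exists_tendsto_ultrafilter (Ultrafilter.of l) (h𝒰 hS)
  have hA1 : ‖A‖ ≤ 1 := norm_le_one_of_tendsto (h𝒰 hS) hA
  have hdense : ∀ i j, Tendsto (fun z => ⟪b j, S z (a i)⟫_ℂ) l (𝓝 ⟪b j, A (a i)⟫_ℂ) := by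
    intro i j
    obtain ⟨L, hL⟩ := h i j
    rwa [tendsto_nhds_unique (hA (a i) (b j)) (hL.mono_left h𝒰)]
  refine ⟨A, fun u y => Metric.tendsto_nhds.2 fun ε hε => ?_⟩
  -- The factor `2` accounts for replacing `(u, y)` by nearby dense vectors twice, once for `S z`
  -- and once for `A`.
  have hcont : Continuous fun p : U × Y => 2 * (‖p.1‖ * ‖y - p.2‖ + ‖u - p.1‖ * ‖y‖) := by
    fun_prop
  obtain ⟨⟨i, j⟩, hij⟩ := (ha.prodMap hb).exists_mem_open
    (isOpen_lt hcont (continuous_const (y := ε / 2))) ⟨(u, y), by simpa using hε⟩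
  simp only [Prod.map, Set.mem_ofPred_eq] at hij
  filter_upwards [hS, Metric.tendsto_nhds.1 (hdense i j) (ε / 2) (by positivity)] with z hz hz2
  have hdiff : ∀ T : U →L[ℂ] Y, ‖T‖ ≤ 1 → ‖⟪y, T u⟫_ℂ - ⟪b j, T (a i)⟫_ℂ‖ ≤
      ‖a i‖ * ‖y - b j‖ + ‖u - a i‖ * ‖y‖ := by
    intro T hT
    have h1 : ⟪y, T u⟫_ℂ - ⟪b j, T (a i)⟫_ℂ = ⟪y - b j, T (a i)⟫_ℂ + ⟪y, T (u - a i)⟫_ℂ := by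
      rw [map_sub, inner_sub_left, inner_sub_right]; ring
    rw [h1]
    exact (norm_add_le _ _).trans
      (add_le_add (norm_inner_clm_le hT _ _) (norm_inner_clm_le hT _ _))
  rw [dist_eq_norm] at hz2 ⊢
  have h1 : ⟪y, S z u⟫_ℂ - ⟪y, A u⟫_ℂ = (⟪y, S z u⟫_ℂ - ⟪b j, S z (a i)⟫_ℂ) +
      (⟪b j, S z (a i)⟫_ℂ - ⟪b j, A (a i)⟫_ℂ) - (⟪y, A u⟫_ℂ - ⟪b j, A (a i)⟫_ℂ) := by ring
  rw [h1]
  have h2 := norm_sub_le ((⟪y, S z u⟫_ℂ - ⟪b j, S z (a i)⟫_ℂ) +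
      (⟪b j, S z (a i)⟫_ℂ - ⟪b j, A (a i)⟫_ℂ)) (⟪y, A u⟫_ℂ - ⟪b j, A (a i)⟫_ℂ)
  have h3 := norm_add_le (⟪y, S z u⟫_ℂ - ⟪b j, S z (a i)⟫_ℂ)
      (⟪b j, S z (a i)⟫_ℂ - ⟪b j, A (a i)⟫_ℂ)
  have h4 := hdiff (S z) hz
  have h5 := hdiff A hA1
  linarith

/-- Radial approach is nontangential. -/
theorem tendsto_circleMap_nontangential (t : ℝ) {M : ℝ} (hM : 1 < M) :
    Tendsto (fun r : ℝ => circleMap 0 r t) (𝓝[<] 1)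
      (𝓝[{z : ℂ | ‖z‖ < 1 ∧ ‖z - circleMap 0 1 t‖ < M * (1 - ‖z‖)}] (circleMap 0 1 t)) := by
  refine tendsto_nhdsWithin_iff.2 ⟨?_, ?_⟩
  · have : Continuous fun r : ℝ => circleMap 0 r t := by
      simp only [circleMap]; fun_prop
    exact (this.tendsto 1).mono_left nhdsWithin_le_nhds
  · filter_upwards [Ioo_mem_nhdsLT (show (0 : ℝ) < 1 by norm_num)] with r hr
    have h1 : ‖circleMap 0 r t‖ = r := by simp [abs_of_pos hr.1]
    have h2 : circleMap 0 r t - circleMap 0 1 t = ((r - 1 : ℝ) : ℂ) * circleMap 0 1 t := by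
      simp [circleMap]; ring
    have h3 : ‖circleMap 0 r t - circleMap 0 1 t‖ = 1 - r := by
      rw [h2, norm_mul, Complex.norm_real, Real.norm_eq_abs, abs_sub_comm,
        abs_of_pos (sub_pos.2 hr.2)]
      simp
    simp only [h1, h3]
    exact ⟨hr.2, by nlinarith [hr.2]⟩

theorem HasNontangentialLimit.tendsto_radial {S : ℂ → U →L[ℂ] Y} {t : ℝ} {A : U →L[ℂ] Y}
    (h : HasNontangentialLimit S (circleMap 0 1 t) A) (u : U) (y : Y) :
    Tendsto (fun r : ℝ => ⟪y, S (circleMap 0 r t) u⟫_ℂ) (𝓝[<] 1) (𝓝 ⟪y, A u⟫_ℂ) :=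
  (h 2 one_lt_two u y).comp (tendsto_circleMap_nontangential t one_lt_two)

theorem eventually_norm_circleMap_lt_one (t : ℝ) :
    ∀ᶠ r : ℝ in 𝓝[<] 1, circleMap 0 r t ∈ ball (0 : ℂ) 1 := by
  filter_upwards [Ioo_mem_nhdsLT (show (0 : ℝ) < 1 by norm_num)] with r hr
  simpa [abs_of_pos hr.1] using hr.2

theorem HasNontangentialLimit.norm_le_one {S : ℂ → U →L[ℂ] Y} (hS : IsSchur S) {t : ℝ}
    {A : U →L[ℂ] Y} (h : HasNontangentialLimit S (circleMap 0 1 t) A) : ‖A‖ ≤ 1 :=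
  norm_le_one_of_tendsto (l := 𝓝[<] (1 : ℝ)) (S := fun r => S (circleMap 0 r t))
    ((eventually_norm_circleMap_lt_one t).mono fun _ hr => hS.norm_le_one _ hr)
    fun u y => h.tendsto_radial u y

/-- Fatou's theorem for the Schur class. -/
theorem IsSchur.exists_isBoundaryFunction [TopologicalSpace.SeparableSpace U]
    [TopologicalSpace.SeparableSpace Y] {S : ℂ → U →L[ℂ] Y} (hS : IsSchur S) :
    ∃ B : ℂ → U →L[ℂ] Y, IsBoundaryFunction S B := by
  classical
  refine ⟨fun ζ => if h : ∃ A, HasNontangentialLimit S ζ A then h.choose else 0, ?_⟩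
  have hae : ∀ᵐ t : ℝ, ∀ i j : ℕ, ∃ a : ℂ, ∀ M : ℝ, 1 < M →
      Tendsto (fun z => ⟪TopologicalSpace.denseSeq Y j, S z (TopologicalSpace.denseSeq U i)⟫_ℂ)
        (𝓝[{z : ℂ | ‖z‖ < 1 ∧ ‖z - circleMap 0 1 t‖ < M * (1 - ‖z‖)}] (circleMap 0 1 t))
        (𝓝 a) := by
    refine MeasureTheory.ae_all_iff.2 fun i => MeasureTheory.ae_all_iff.2 fun j => ?_
    refine ae_exists_nontangential_limit ?_
      (fun z hz => norm_inner_clm_le (hS.norm_le_one z hz) _ _)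
    have h1 : DifferentiableOn ℂ (fun z => S z (TopologicalSpace.denseSeq U i)) (ball 0 1) :=
      hS.differentiableOn.clm_apply (differentiableOn_const _)
    exact (innerSL ℂ (TopologicalSpace.denseSeq Y j)).differentiable.comp_differentiableOn h1
  filter_upwards [hae] with t ht
  have hex : ∃ A, HasNontangentialLimit S (circleMap 0 1 t) A := by
    -- The supremum over all apertures `M` is used so that one operator `A` serves every approach
    -- region.
    let l : Filter ℂ := ⨆ M : Set.Ioi (1 : ℝ),
      𝓝[{z : ℂ | ‖z‖ < 1 ∧ ‖z - circleMap 0 1 t‖ < M * (1 - ‖z‖)}] (circleMap 0 1 t)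
    have hl2 := (tendsto_circleMap_nontangential t one_lt_two).neBot
    have hl : l.NeBot := hl2.mono (le_iSup (fun M : Set.Ioi (1 : ℝ) =>
      𝓝[{z : ℂ | ‖z‖ < 1 ∧ ‖z - circleMap 0 1 t‖ < M * (1 - ‖z‖)}] (circleMap 0 1 t))
      ⟨2, Set.mem_Ioi.2 one_lt_two⟩)
    obtain ⟨A, hA⟩ := exists_weak_limit_of_dense (l := l) (S := S)
      (eventually_iSup.2 fun M => by
        filter_upwards [self_mem_nhdsWithin] with z hz
        exact hS.norm_le_one z (by simpa using hz.1))
      (TopologicalSpace.denseRange_denseSeq U) (TopologicalSpace.denseRange_denseSeq Y)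
      (fun i j => by
        obtain ⟨L, hL⟩ := ht i j
        exact ⟨L, tendsto_iSup.2 fun M => hL M M.2⟩)
    exact ⟨A, fun M hM u y => tendsto_iSup.1 (hA u y) ⟨M, hM⟩⟩
  rw [dif_pos hex]
  exact hex.choose_spec

end

/-! ### Scalar power series on circles and Parseval's identity at the boundary -/

theorem continuousOn_tsum_pow_smul {E : Type*} [NormedAddCommGroup E] [NormedSpace ℂ E]
    [CompleteSpace E] {p : ℕ → E} {A : ℝ} (hp : ∀ n, ‖p n‖ ≤ A) {r : ℝ} (hr : 0 ≤ r)
    (hr1 : r < 1) : ContinuousOn (fun z : ℂ => ∑' n, z ^ n • p n) (closedBall 0 r) := by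
  refine continuousOn_tsum (u := fun n => r ^ n * A) (fun n => by fun_prop)
    ((summable_geometric_of_lt_one hr hr1).mul_right A) fun n z hz => ?_
  rw [norm_smul, norm_pow]
  have hz1 : ‖z‖ ≤ r := by simpa using hz
  gcongr
  exact hp n

theorem summable_pow_smul {E : Type*} [NormedAddCommGroup E] [NormedSpace ℂ E]
    {p : ℕ → E} {A : ℝ} (hp : ∀ n, ‖p n‖ ≤ A) {z : ℂ} (hz : ‖z‖ < 1) :
    Summable fun n : ℕ => ‖z ^ n • p n‖ := by
  refine Summable.of_nonneg_of_le (fun _ => norm_nonneg _) (fun n => ?_)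
    ((summable_geometric_of_lt_one (norm_nonneg _) hz).mul_right A)
  rw [norm_smul, norm_pow]
  gcongr
  exact hp n

/-- Termwise integration of a power series against a continuous function on a circle. -/
theorem circleAverage_tsum_mul {p : ℕ → ℂ} {A : ℝ} (hp : ∀ n, ‖p n‖ ≤ A) {r : ℝ} (hr : 0 < r)
    (hr1 : r < 1) {g : ℂ → ℂ} (hg : ContinuousOn g (sphere 0 r)) :
    Real.circleAverage (fun z => (∑' n, z ^ n • p n) * g z) 0 r =
      ∑' n, p n * Real.circleAverage (fun z => z ^ n * g z) 0 r := by
  obtain ⟨G, hG⟩ := (isCompact_sphere (0 : ℂ) r).exists_bound_of_continuousOn hg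
  have hmem : ∀ t, circleMap 0 r t ∈ sphere (0 : ℂ) r := fun t => circleMap_mem_sphere 0 hr.le t
  have hgc : Continuous fun t => g (circleMap 0 r t) :=
    hg.comp_continuous (continuous_circleMap 0 r) hmem
  have h := intervalIntegral.hasSum_integral_of_dominated_convergence (μ := volume)
    (a := 0) (b := 2 * Real.pi)
    (F := fun n t => circleMap 0 r t ^ n • p n * g (circleMap 0 r t))
    (f := fun t => (∑' n, circleMap 0 r t ^ n • p n) * g (circleMap 0 r t))
    (fun n _ => r ^ n * A * G) (fun n => by
      refine Continuous.aestronglyMeasurable ?_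
      exact (((continuous_circleMap 0 r).pow n).smul continuous_const).mul hgc)
    (fun n => .of_forall fun t _ => by
      rw [norm_mul, norm_smul, norm_pow, mem_sphere_zero_iff_norm.1 (hmem t)]
      have hA : 0 ≤ A := (norm_nonneg _).trans (hp n)
      gcongr
      · exact hp n
      · exact hG _ (hmem t))
    (.of_forall fun t _ => ((summable_geometric_of_lt_one hr.le hr1).mul_right A).mul_right G)
    intervalIntegrable_const
    (.of_forall fun t _ => by
      refine HasSum.mul_right _ (Summable.hasSum ?_)
      exact (summable_pow_smul hp (by rw [mem_sphere_zero_iff_norm.1 (hmem t)]; exact hr1)).of_norm)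
  have h2 := h.const_smul ((2 * Real.pi)⁻¹ : ℝ)
  rw [Real.circleAverage, ← h2.tsum_eq]
  refine tsum_congr fun n => ?_
  rw [Real.circleAverage, mul_smul_comm, ← intervalIntegral.integral_const_mul]
  congr 2
  ext t
  simp only [smul_eq_mul]
  ring

theorem circleAverage_pow_mul_conj_pow {r : ℝ} (hr : 0 < r) (hr1 : r < 1) (n m : ℕ) :
    Real.circleAverage (fun z => z ^ n * conj z ^ m) 0 r =
      if n = m then (r : ℂ) ^ (2 * m) else 0 := by
  have := circleAverage_shift (S := fun _ => ContinuousLinearMap.id ℂ ℂ)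
    (differentiableOn_const _) hr hr1 1 n m
  simp only [ContinuousLinearMap.id_apply, smul_eq_mul, mul_one] at this
  simp_rw [mul_comm _ (conj _ ^ m), this]
  rcases lt_trichotomy n m with h | h | h
  · have h0 : m - n ≠ 0 := by omega
    rw [if_pos h.le, if_neg h.ne, taylorCoeff]
    simp [iteratedDeriv_const, h0]
  · subst h
    simp [taylorCoeff]
  · rw [if_neg (by omega), if_neg (by omega), mul_zero]

theorem circleAverage_conj {r : ℝ} (f : ℂ → ℂ) :
    Real.circleAverage (fun z => conj (f z)) 0 r = conj (Real.circleAverage f 0 r) := by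
  simp only [Real.circleAverage, Complex.real_smul, map_mul, Complex.conj_ofReal]
  rw [intervalIntegral, intervalIntegral, integral_conj, integral_conj, map_sub]

/-- Coefficient extraction for power series. -/
theorem circleAverage_tsum_mul_conj_pow {q : ℕ → ℂ} {A : ℝ} (hq : ∀ n, ‖q n‖ ≤ A) {r : ℝ}
    (hr : 0 < r) (hr1 : r < 1) (m : ℕ) :
    Real.circleAverage (fun z => (∑' n, z ^ n • q n) * conj z ^ m) 0 r =
      q m * (r : ℂ) ^ (2 * m) := by
  rw [circleAverage_tsum_mul hq hr hr1 (g := fun z => conj z ^ m) (by fun_prop)]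
  simp_rw [circleAverage_pow_mul_conj_pow hr hr1, mul_ite, mul_zero]
  rw [tsum_ite_eq]

/-- Parseval's identity on the circle of radius `r`: integrate one series termwise, so that each
term extracts a coefficient of the other. -/
theorem circleAverage_conj_tsum_mul_tsum {p q : ℕ → ℂ} {A : ℝ} (hp : ∀ n, ‖p n‖ ≤ A)
    (hq : ∀ n, ‖q n‖ ≤ A) {r : ℝ} (hr : 0 < r) (hr1 : r < 1) :
    Real.circleAverage (fun z => conj (∑' n, z ^ n • p n) * ∑' n, z ^ n • q n) 0 r =
      ∑' n, (r : ℂ) ^ (2 * n) * (conj (p n) * q n) := by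
  have hqc : ContinuousOn (fun z : ℂ => ∑' n, z ^ n • q n) (sphere 0 r) :=
    (continuousOn_tsum_pow_smul hq hr.le hr1).mono sphere_subset_closedBall
  have h1 : ∀ m, Real.circleAverage (fun z => z ^ m * conj (∑' n, z ^ n • q n)) 0 r =
      (r : ℂ) ^ (2 * m) * conj (q m) := by
    intro m
    have h3 := congrArg conj (circleAverage_tsum_mul_conj_pow hq hr hr1 m)
    rw [← circleAverage_conj] at h3
    simp only [map_mul, map_pow, Complex.conj_conj, Complex.conj_ofReal] at h3
    rw [mul_comm ((r : ℂ) ^ (2 * m)), ← h3]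
    congr 1
    ext z
    rw [mul_comm]
  have h2 := circleAverage_tsum_mul hp hr hr1 (g := fun z => conj (∑' n, z ^ n • q n))
    (Complex.continuous_conj.comp_continuousOn hqc)
  simp_rw [h1] at h2
  have h3 := congrArg conj h2
  rw [← circleAverage_conj, Complex.conj_tsum] at h3
  simp only [map_mul, map_pow, Complex.conj_conj, Complex.conj_ofReal] at h3
  rw [h3]
  refine tsum_congr fun n => ?_
  ring

theorem exists_seq_tendsto_one :
    ∃ r : ℕ → ℝ, (∀ k, 0 < r k ∧ r k < 1) ∧ Tendsto r atTop (𝓝[<] 1) := by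
  obtain ⟨r, -, hr, hr1⟩ := exists_seq_strictMono_tendsto' (show (0 : ℝ) < 1 by norm_num)
  exact ⟨r, hr, tendsto_nhdsWithin_iff.2 ⟨hr1, .of_forall fun k => (hr k).2⟩⟩

/-- Along a sequence of radii tending to one, the boundary function is an almost everywhere limit of
continuous functions of the angle. -/
theorem aestronglyMeasurable_of_radial {F b : ℂ → ℂ} (hF : ContinuousOn F (ball 0 1))
    (hb : ∀ᵐ t : ℝ, Tendsto (fun r : ℝ => F (circleMap 0 r t)) (𝓝[<] 1)
      (𝓝 (b (circleMap 0 1 t)))) :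
    AEStronglyMeasurable (fun t : ℝ => b (circleMap 0 1 t)) := by
  obtain ⟨r, hr, hr1⟩ := exists_seq_tendsto_one
  refine aestronglyMeasurable_of_tendsto_ae atTop (f := fun k t => F (circleMap 0 (r k) t))
    (fun k => ?_) (hb.mono fun t ht => ht.comp hr1)
  refine (hF.comp_continuous (continuous_circleMap 0 _) fun t => ?_).aestronglyMeasurable
  simpa [abs_of_pos (hr k).1] using (hr k).2

/-- Parseval's identity for the boundary values of bounded scalar power series. -/
theorem circleAverage_conj_mul_boundary {p q : ℕ → ℂ} (hp : Summable fun n => ‖p n‖ ^ 2)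
    (hq : Summable fun n => ‖q n‖ ^ 2) {C : ℝ}
    (hpC : ∀ z ∈ ball (0 : ℂ) 1, ‖∑' n, z ^ n • p n‖ ≤ C)
    (hqC : ∀ z ∈ ball (0 : ℂ) 1, ‖∑' n, z ^ n • q n‖ ≤ C) {b c : ℂ → ℂ}
    (hb : ∀ᵐ t : ℝ, Tendsto (fun r : ℝ => ∑' n, circleMap 0 r t ^ n • p n) (𝓝[<] 1)
      (𝓝 (b (circleMap 0 1 t))))
    (hc : ∀ᵐ t : ℝ, Tendsto (fun r : ℝ => ∑' n, circleMap 0 r t ^ n • q n) (𝓝[<] 1)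
      (𝓝 (c (circleMap 0 1 t)))) :
    Real.circleAverage (fun ζ => conj (b ζ) * c ζ) 0 1 = ∑' n, conj (p n) * q n := by
  obtain ⟨A, hpA, hqA⟩ : ∃ A, (∀ n, ‖p n‖ ≤ A) ∧ ∀ n, ‖q n‖ ≤ A := by
    refine ⟨max (√(∑' n, ‖p n‖ ^ 2)) (√(∑' n, ‖q n‖ ^ 2)), fun n => le_max_of_le_left ?_,
      fun n => le_max_of_le_right ?_⟩
    · exact Real.le_sqrt_of_sq_le (hp.le_tsum n fun _ _ => sq_nonneg _)
    · exact Real.le_sqrt_of_sq_le (hq.le_tsum n fun _ _ => sq_nonneg _)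
  obtain ⟨r, hr, hr1⟩ := exists_seq_tendsto_one
  have hmem : ∀ k t, circleMap 0 (r k) t ∈ ball (0 : ℂ) 1 := fun k t => by
    simpa [abs_of_pos (hr k).1] using (hr k).2
  have hcont : ∀ p : ℕ → ℂ, (∀ n, ‖p n‖ ≤ A) → ∀ k,
      Continuous fun t => ∑' n, circleMap 0 (r k) t ^ n • p n := fun p hp k =>
    (continuousOn_tsum_pow_smul hp (hr k).1.le (hr k).2).comp_continuous
      (continuous_circleMap 0 _) fun t => circleMap_mem_closedBall 0 (hr k).1.le t
  have hC0 : 0 ≤ C := (norm_nonneg _).trans (hpC 0 (by simp))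
  -- Let the radius tend to one on both sides of Parseval's identity: boundedness dominates the
  -- integrals, square-summability dominates the series.
  have h1 : Tendsto (fun k => Real.circleAverage
      (fun z => conj (∑' n, z ^ n • p n) * ∑' n, z ^ n • q n) 0 (r k)) atTop
      (𝓝 (Real.circleAverage (fun ζ => conj (b ζ) * c ζ) 0 1)) := by
    refine Tendsto.const_smul ?_ _
    refine intervalIntegral.tendsto_integral_filter_of_dominated_convergence (fun _ => C * C)
      (.of_forall fun k => ?_) (.of_forall fun k => .of_forall fun t _ => ?_)
      intervalIntegrable_const ?_
    · exact ((Complex.continuous_conj.comp (hcont p hpA k)).mul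
        (hcont q hqA k)).aestronglyMeasurable
    · rw [norm_mul, RCLike.norm_conj]
      exact mul_le_mul (hpC _ (hmem k t)) (hqC _ (hmem k t)) (norm_nonneg _) hC0
    · filter_upwards [hb, hc] with t hbt hct _
      exact ((Complex.continuous_conj.tendsto _).comp (hbt.comp hr1)).mul (hct.comp hr1)
  have h2 : Tendsto (fun k => ∑' n, (r k : ℂ) ^ (2 * n) * (conj (p n) * q n)) atTop
      (𝓝 (∑' n, conj (p n) * q n)) := by
    refine tendsto_tsum_of_dominated_convergence (bound := fun n => ‖p n‖ ^ 2 + ‖q n‖ ^ 2)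
      (hp.add hq) (fun n => ?_) (.of_forall fun k n => ?_)
    · have h3 : Continuous fun x : ℝ => (x : ℂ) ^ (2 * n) * (conj (p n) * q n) := by fun_prop
      have h4 := (h3.tendsto 1).comp (hr1.mono_right nhdsWithin_le_nhds)
      simpa [Function.comp_def] using h4
    · rw [norm_mul, norm_mul, norm_pow, RCLike.norm_conj, Complex.norm_real, Real.norm_eq_abs,
        abs_of_pos (hr k).1]
      refine (mul_le_of_le_one_left (by positivity)
        (pow_le_one₀ (hr k).1.le (hr k).2.le)).trans ?_
      nlinarith [sq_nonneg (‖p n‖ - ‖q n‖), sq_nonneg ‖p n‖, sq_nonneg ‖q n‖]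
  refine tendsto_nhds_unique h1 (h2.congr fun k => ?_)
  rw [circleAverage_conj_tsum_mul_tsum hpA hqA (hr k).1 (hr k).2]

/-- Distinct members are at distance `√2`, so the balls of radius `1/2` around them are disjoint
open sets. Countable bases are what allow sums over coordinates to be exchanged with integrals. -/
theorem countable_of_orthonormal {E ι : Type*} [NormedAddCommGroup E] [InnerProductSpace ℂ E]
    [TopologicalSpace.SeparableSpace E] {v : ι → E} (hv : Orthonormal ℂ v) : Countable ι := by
  refine Pairwise.countable_of_isOpen_disjoint (s := fun i => ball (v i) (1 / 2))
    (fun i j hij => ball_disjoint_ball ?_) (fun _ => isOpen_ball)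
    fun i => nonempty_ball.2 (by norm_num)
  have h1 := norm_sub_sq (𝕜 := ℂ) (v i) (v j)
  rw [hv.2 hij, hv.1, hv.1] at h1
  have h2 : ‖v i - v j‖ ^ 2 = 2 := by rw [h1]; norm_num
  rw [dist_eq_norm]
  nlinarith [norm_nonneg (v i - v j)]

theorem summable_norm_sq_hardy {E : Type*} [NormedAddCommGroup E] [InnerProductSpace ℂ E]
    (P : HardySpace E) : Summable fun n => ‖P n‖ ^ 2 := by
  have := (lp.memℓp P).summable (by norm_num)
  simpa using this

/-! ### Weak boundary values and Parseval's identity in a Hilbert space -/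

section
variable {Y : Type*} [NormedAddCommGroup Y] [InnerProductSpace ℂ Y] [CompleteSpace Y]

/-- `b` is almost everywhere the weak radial limit of `F`. -/
def HasWeakBoundaryValues (F b : ℂ → Y) : Prop :=
  ∀ᵐ t : ℝ, ∀ y : Y, Tendsto (fun r : ℝ => ⟪y, F (circleMap 0 r t)⟫_ℂ) (𝓝[<] 1)
    (𝓝 ⟪y, b (circleMap 0 1 t)⟫_ℂ)

theorem HasWeakBoundaryValues.ae_norm_le {F b : ℂ → Y} (h : HasWeakBoundaryValues F b) {C : ℝ}
    (hF : ∀ z ∈ ball (0 : ℂ) 1, ‖F z‖ ≤ C) : ∀ᵐ t : ℝ, ‖b (circleMap 0 1 t)‖ ≤ C := by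
  filter_upwards [h] with t ht
  set y := b (circleMap 0 1 t)
  have h1 : ‖⟪y, y⟫_ℂ‖ ≤ ‖y‖ * C := le_of_tendsto (ht y).norm
    ((eventually_norm_circleMap_lt_one t).mono fun r hr =>
      (norm_inner_le_norm _ _).trans (by gcongr; exact hF _ hr))
  rw [inner_self_eq_norm_sq_to_K, norm_pow, RCLike.norm_ofReal, abs_norm, sq] at h1
  rcases (norm_nonneg y).eq_or_lt with h0 | h0
  · rw [← h0]; exact (norm_nonneg _).trans (hF 0 (by simp))
  · exact le_of_mul_le_mul_left h1 h0

/-- Each coordinate in a countable Hilbert basis is measurable as a radial limit, and the expansion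
of `b` converges in norm at every point. -/
theorem HasWeakBoundaryValues.aestronglyMeasurable [TopologicalSpace.SeparableSpace Y]
    {F b : ℂ → Y} (h : HasWeakBoundaryValues F b) (hF : ContinuousOn F (ball 0 1)) :
    AEStronglyMeasurable (fun t : ℝ => b (circleMap 0 1 t)) := by
  obtain ⟨w, e, -⟩ := exists_hilbertBasis ℂ Y
  have : Countable w := countable_of_orthonormal e.orthonormal
  refine aestronglyMeasurable_of_tendsto_ae atTop
    (f := fun s t => ∑ i ∈ s, ⟪e i, b (circleMap 0 1 t)⟫_ℂ • e i) (fun s => ?_)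
    (.of_forall fun t => ?_)
  · refine Finset.aestronglyMeasurable_fun_sum s fun i _ => ?_
    refine AEStronglyMeasurable.smul_const ?_ _
    exact aestronglyMeasurable_of_radial (F := fun z => ⟪e i, F z⟫_ℂ)
      (b := fun z => ⟪e i, b z⟫_ℂ) (by fun_prop) (h.mono fun t ht => ht _)
  · have := e.hasSum_repr (b (circleMap 0 1 t))
    simp only [e.repr_apply_apply] at this
    exact this

theorem hasSum_norm_inner_sq {ι : Type*} (e : HilbertBasis ι ℂ Y) (y : Y) :
    HasSum (fun i => ‖⟪e i, y⟫_ℂ‖ ^ 2) (‖y‖ ^ 2) := by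
  have h1 := e.hasSum_inner_mul_inner y y
  rw [inner_self_eq_norm_sq_to_K] at h1
  have h2 : ∀ i, ⟪y, e i⟫_ℂ * ⟪e i, y⟫_ℂ = ((‖⟪e i, y⟫_ℂ‖ ^ 2 : ℝ) : ℂ) := by
    intro i
    rw [← inner_conj_symm, mul_comm, Complex.mul_conj, Complex.normSq_eq_norm_sq]
  simp only [h2] at h1
  have h3 : ((‖y‖ : ℂ)) ^ 2 = ((‖y‖ ^ 2 : ℝ) : ℂ) := by push_cast; rfl
  exact Complex.hasSum_ofReal.1 (h3 ▸ h1)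

/-- A majorant for one coordinate of `⟪x, y⟫` whose sum over a Hilbert basis is `‖x‖² + ‖y‖²`; it
justifies the exchanges of sums and integrals. -/
theorem norm_inner_mul_inner_le (x y z : Y) :
    ‖⟪x, z⟫_ℂ * ⟪z, y⟫_ℂ‖ ≤ ‖⟪z, x⟫_ℂ‖ ^ 2 + ‖⟪z, y⟫_ℂ‖ ^ 2 := by
  rw [norm_mul, norm_inner_symm x z]
  nlinarith [sq_nonneg (‖⟪z, x⟫_ℂ‖ - ‖⟪z, y⟫_ℂ‖), sq_nonneg ‖⟪z, x⟫_ℂ‖, sq_nonneg ‖⟪z, y⟫_ℂ‖]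

theorem norm_hardy_apply_le (P : HardySpace Y) (n : ℕ) : ‖P n‖ ≤ ‖P‖ :=
  lp.norm_apply_le_norm (by norm_num) P n

theorem continuousOn_hardy (P : HardySpace Y) :
    ContinuousOn (fun z : ℂ => ∑' n, z ^ n • P n) (ball 0 1) := by
  intro z hz
  obtain ⟨r, hr, hr1⟩ := exists_between (mem_ball_zero_iff.1 hz)
  exact ((continuousOn_tsum_pow_smul (norm_hardy_apply_le P) ((norm_nonneg z).trans hr.le)
    hr1).continuousAt (mem_of_superset (isOpen_ball.mem_nhds (mem_ball_zero_iff.2 hr))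
      ball_subset_closedBall)).continuousWithinAt

theorem tsum_pow_smul_inner (P : HardySpace Y) (y : Y) {z : ℂ} (hz : z ∈ ball (0 : ℂ) 1) :
    ∑' n, z ^ n • ⟪y, P n⟫_ℂ = ⟪y, ∑' n, z ^ n • P n⟫_ℂ := by
  have h1 := (innerSL ℂ y).map_tsum
    (summable_pow_smul (norm_hardy_apply_le P) (mem_ball_zero_iff.1 hz)).of_norm
  simp only [innerSL_apply_apply, inner_smul_right] at h1
  exact h1.symm

/-- Parseval's identity for one coordinate. -/
theorem circleAverage_inner_mul_inner_boundary (P Q : HardySpace Y)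
    {C : ℝ} (hP : ∀ z ∈ ball (0 : ℂ) 1, ‖∑' n, z ^ n • P n‖ ≤ C)
    (hQ : ∀ z ∈ ball (0 : ℂ) 1, ‖∑' n, z ^ n • Q n‖ ≤ C) {b c : ℂ → Y}
    (hb : HasWeakBoundaryValues (fun z => ∑' n, z ^ n • P n) b)
    (hc : HasWeakBoundaryValues (fun z => ∑' n, z ^ n • Q n) c) {y : Y} (hy : ‖y‖ = 1) :
    Real.circleAverage (fun ζ => ⟪b ζ, y⟫_ℂ * ⟪y, c ζ⟫_ℂ) 0 1 =
      ∑' n, ⟪P n, y⟫_ℂ * ⟪y, Q n⟫_ℂ := by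
  have hei : ∀ x : Y, ‖⟪y, x⟫_ℂ‖ ≤ ‖x‖ := fun x => by
    simpa [hy] using norm_inner_le_norm (𝕜 := ℂ) y x
  have hcoefsum : ∀ P : HardySpace Y, Summable fun n => ‖⟪y, P n⟫_ℂ‖ ^ 2 := by
    intro P
    refine (summable_norm_sq_hardy P).of_nonneg_of_le (fun _ => sq_nonneg _) fun n => ?_
    gcongr
    exact hei _
  have hrad : ∀ {P : HardySpace Y} {b : ℂ → Y},
      HasWeakBoundaryValues (fun z => ∑' n, z ^ n • P n) b → ∀ᵐ t : ℝ,
      Tendsto (fun r : ℝ => ∑' n, circleMap 0 r t ^ n • ⟪y, P n⟫_ℂ) (𝓝[<] 1)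
        (𝓝 ⟪y, b (circleMap 0 1 t)⟫_ℂ) := by
    intro P b hb
    filter_upwards [hb] with t ht
    refine (ht y).congr' ?_
    filter_upwards [eventually_norm_circleMap_lt_one t] with r hr
    exact (tsum_pow_smul_inner P y hr).symm
  have h1 := circleAverage_conj_mul_boundary (hcoefsum P) (hcoefsum Q) (C := C)
    (b := fun z => ⟪y, b z⟫_ℂ) (c := fun z => ⟪y, c z⟫_ℂ)
    (fun z hz => by rw [tsum_pow_smul_inner P y hz]; exact (hei _).trans (hP z hz))
    (fun z hz => by rw [tsum_pow_smul_inner Q y hz]; exact (hei _).trans (hQ z hz))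
    (hrad hb) (hrad hc)
  simpa only [inner_conj_symm] using h1

theorem summable_norm_inner_sq {ι : Type*} (e : HilbertBasis ι ℂ Y) {p : ℕ → Y}
    (hp : Summable fun n => ‖p n‖ ^ 2) : Summable fun x : ℕ × ι => ‖⟪e x.2, p x.1⟫_ℂ‖ ^ 2 := by
  refine (summable_prod_of_nonneg fun _ => sq_nonneg _).2
    ⟨fun n => (hasSum_norm_inner_sq e (p n)).summable, ?_⟩
  simpa only [fun n => (hasSum_norm_inner_sq e (p n)).tsum_eq] using hp

theorem tsum_tsum_inner_mul_inner {ι : Type*} (e : HilbertBasis ι ℂ Y) {p q : ℕ → Y}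
    (hp : Summable fun n => ‖p n‖ ^ 2) (hq : Summable fun n => ‖q n‖ ^ 2) :
    ∑' i, ∑' n, ⟪p n, e i⟫_ℂ * ⟪e i, q n⟫_ℂ = ∑' n, ⟪p n, q n⟫_ℂ := by
  have hpq : Summable fun x : ℕ × ι => ⟪p x.1, e x.2⟫_ℂ * ⟪e x.2, q x.1⟫_ℂ :=
    Summable.of_norm_bounded ((summable_norm_inner_sq e hp).add (summable_norm_inner_sq e hq))
      fun x => norm_inner_mul_inner_le _ _ _
  rw [Summable.tsum_comm (f := fun n i => ⟪p n, e i⟫_ℂ * ⟪e i, q n⟫_ℂ) hpq]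
  exact tsum_congr fun n => e.tsum_inner_mul_inner _ _

/-- Parseval's identity: the inner product of two bounded functions in `H²(Y)` is the average of the
inner product of their boundary values. -/
theorem circleAverage_inner_boundary [TopologicalSpace.SeparableSpace Y] (P Q : HardySpace Y)
    {C : ℝ} (hP : ∀ z ∈ ball (0 : ℂ) 1, ‖∑' n, z ^ n • P n‖ ≤ C)
    (hQ : ∀ z ∈ ball (0 : ℂ) 1, ‖∑' n, z ^ n • Q n‖ ≤ C) {b c : ℂ → Y}
    (hb : HasWeakBoundaryValues (fun z => ∑' n, z ^ n • P n) b)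
    (hc : HasWeakBoundaryValues (fun z => ∑' n, z ^ n • Q n) c) :
    CircleIntegrable (fun ζ => ⟪b ζ, c ζ⟫_ℂ) 0 1 ∧
      Real.circleAverage (fun ζ => ⟪b ζ, c ζ⟫_ℂ) 0 1 = ⟪P, Q⟫_ℂ := by
  obtain ⟨w, e, -⟩ := exists_hilbertBasis ℂ Y
  have : Countable w := countable_of_orthonormal e.orthonormal
  have hbm := hb.aestronglyMeasurable (continuousOn_hardy P)
  have hcm := hc.aestronglyMeasurable (continuousOn_hardy Q)
  have hbC := hb.ae_norm_le hP
  have hcC := hc.ae_norm_le hQ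
  have hC0 : 0 ≤ C := (norm_nonneg _).trans (hP 0 (by simp))
  have hint : IntervalIntegrable (fun t => ⟪b (circleMap 0 1 t), c (circleMap 0 1 t)⟫_ℂ) volume
      0 (2 * Real.pi) := by
    refine IntervalIntegrable.mono_fun' (g := fun _ => C * C) intervalIntegrable_const
      (hbm.inner hcm).restrict (ae_restrict_of_ae ?_)
    filter_upwards [hbC, hcC] with t h1 h2
    exact (norm_inner_le_norm _ _).trans (mul_le_mul h1 h2 (norm_nonneg _) hC0)
  refine ⟨hint, ?_⟩
  -- Weak convergence does not pass to inner products of two varying vectors, so the inner product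
  -- is expanded in a basis and the scalar identity is applied to each coordinate. The majorants sum
  -- to at most `2 C²` almost everywhere.
  have hsum : HasSum (fun i => Real.circleAverage (fun ζ => ⟪b ζ, e i⟫_ℂ * ⟪e i, c ζ⟫_ℂ) 0 1)
      (Real.circleAverage (fun ζ => ⟪b ζ, c ζ⟫_ℂ) 0 1) := by
    refine HasSum.const_smul _ ?_
    refine intervalIntegral.hasSum_integral_of_dominated_convergence
      (fun i t => ‖⟪e i, b (circleMap 0 1 t)⟫_ℂ‖ ^ 2 + ‖⟪e i, c (circleMap 0 1 t)⟫_ℂ‖ ^ 2)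
      (fun i => ?_) (fun i => .of_forall fun t _ => ?_) (.of_forall fun t _ => ?_) ?_
      (.of_forall fun t _ => e.hasSum_inner_mul_inner _ _)
    · exact ((hbm.inner aestronglyMeasurable_const).mul
        (aestronglyMeasurable_const.inner hcm)).restrict
    · exact norm_inner_mul_inner_le _ _ _
    · exact (hasSum_norm_inner_sq e _).summable.add (hasSum_norm_inner_sq e _).summable
    · simp_rw [((hasSum_norm_inner_sq e _).add (hasSum_norm_inner_sq e _)).tsum_eq]
      refine IntervalIntegrable.mono_fun' (g := fun _ => C ^ 2 + C ^ 2) intervalIntegrable_const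
        ((hbm.norm.pow 2).add (hcm.norm.pow 2)).restrict (ae_restrict_of_ae ?_)
      filter_upwards [hbC, hcC] with t h1 h2
      rw [Real.norm_of_nonneg (by positivity)]
      gcongr
  rw [← hsum.tsum_eq, lp.inner_eq_tsum]
  simp_rw [circleAverage_inner_mul_inner_boundary P Q hP hQ hb hc (e.orthonormal.1 _)]
  exact tsum_tsum_inner_mul_inner e (summable_norm_sq_hardy P) (summable_norm_sq_hardy Q)

end

/-! ### Completeness of the overlapping space and its representing elements -/

section
variable {H K : Type*} [NormedAddCommGroup H] [InnerProductSpace ℂ H] [CompleteSpace H]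
  [NormedAddCommGroup K] [InnerProductSpace ℂ K] [CompleteSpace K]

namespace PullbackSpace
variable (T : H →L[ℂ] K)

theorem exists_mk_eq (x : PullbackSpace T) : ∃ a, mk T a = x := by
  obtain ⟨_, a, rfl⟩ := x
  exact ⟨a, rfl⟩

theorem lift_mem (x : PullbackSpace T) : lift T x ∈ (LinearMap.ker T.toLinearMap)ᗮ := by
  obtain ⟨a, rfl⟩ := exists_mk_eq T x
  rw [lift_mk]
  exact Submodule.starProjection_apply_mem _ _

/-- Together with `lift_mem` and `lift_eq_of_mem`, this identifies the pull-back space with `(ker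
T)ᗮ`, the restriction of `T` being the inverse of `lift`. -/
theorem apply_lift (x : PullbackSpace T) : T (lift T x) = x.1 := by
  obtain ⟨a, rfl⟩ := exists_mk_eq T x
  rw [lift_mk]
  have h := Submodule.sub_starProjection_mem_orthogonal
    (K := (LinearMap.ker T.toLinearMap)ᗮ) a
  rw [Submodule.orthogonal_orthogonal, LinearMap.mem_ker] at h
  exact (sub_eq_zero.1 ((map_sub T _ _).symm.trans h)).symm

theorem lift_eq_of_mem {a : H} (ha : a ∈ (LinearMap.ker T.toLinearMap)ᗮ) :
    lift T (mk T a) = a := by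
  rw [lift_mk]
  exact Submodule.starProjection_eq_self_iff.2 ha

end PullbackSpace

namespace OverlappingSpace
variable (T : H →L[ℂ] K)

theorem inner_eq (f g : OverlappingSpace T) :
    ⟪f, g⟫_ℂ = ⟪PullbackSpace.lift _ f.image, PullbackSpace.lift _ g.image⟫_ℂ + ⟪f.val, g.val⟫_ℂ :=
  WithLp.prod_inner_apply (𝕜 := ℂ) (embed T f) (embed T g)

/-- The overlapping space as a subspace of a Hilbert space. -/
noncomputable def isometry : OverlappingSpace T →ₗᵢ[ℂ] WithLp 2 (K × H) where
  toFun f := WithLp.toLp 2 (PullbackSpace.lift _ f.image, f.val)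
  map_add' f g := by
    have h : (f + g).image = f.image + g.image := Subtype.ext (map_add T f.1 g.1)
    rw [h, map_add]
    rfl
  map_smul' c f := by
    have h : (c • f).image = c • f.image := Subtype.ext (map_smul T c f.1)
    rw [h, map_smul]
    rfl
  norm_map' f := by
    rw [← sq_eq_sq₀ (norm_nonneg _) (norm_nonneg _), norm_sq, WithLp.prod_norm_sq_eq_of_L2]
    rfl

/-- Both conditions on the right are closed, which is how completeness is obtained. -/
theorem range_isometry : Set.range (isometry T) =
    {x | x.fst ∈ (LinearMap.ker (CFC.sqrt (1 - T ∘L T.adjoint)).toLinearMap)ᗮ ∧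
      CFC.sqrt (1 - T ∘L T.adjoint) x.fst = T x.snd} := by
  ext x
  constructor
  · rintro ⟨f, rfl⟩
    exact ⟨PullbackSpace.lift_mem _ _, PullbackSpace.apply_lift _ _⟩
  · rintro ⟨h1, h2⟩
    let f : OverlappingSpace T := ⟨x.snd, x.fst, h2⟩
    have hf : f.image = PullbackSpace.mk _ x.fst := Subtype.ext h2.symm
    refine ⟨f, ?_⟩
    change WithLp.toLp 2 (PullbackSpace.lift _ f.image, x.snd) = x
    rw [hf, PullbackSpace.lift_eq_of_mem _ h1]
    rfl

instance : CompleteSpace (OverlappingSpace T) := by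
  rw [completeSpace_iff_isComplete_range (isometry T).isometry.isUniformInducing, range_isometry]
  refine IsClosed.isComplete (IsClosed.inter ?_ ?_)
  · exact (Submodule.isClosed_orthogonal _).preimage (continuous_fst.comp (WithLp.prod_continuous_ofLp 2 K H))
  · exact isClosed_eq ((CFC.sqrt (1 - T ∘L T.adjoint)).continuous.comp
      (continuous_fst.comp (WithLp.prod_continuous_ofLp 2 K H))) (T.continuous.comp (continuous_snd.comp (WithLp.prod_continuous_ofLp 2 K H)))

theorem one_sub_comp_adjoint_nonneg {T : H →L[ℂ] K} (hT : ‖T‖ ≤ 1) :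
    0 ≤ 1 - T ∘L T.adjoint := by
  rw [ContinuousLinearMap.nonneg_iff_isPositive, ContinuousLinearMap.isPositive_iff_complex]
  intro x
  have h1 : ⟪(1 - T ∘L T.adjoint) x, x⟫_ℂ = ((‖x‖ ^ 2 - ‖T.adjoint x‖ ^ 2 : ℝ) : ℂ) := by
    rw [sub_apply, inner_sub_left, one_apply_eq_self,
      ContinuousLinearMap.comp_apply, ← ContinuousLinearMap.adjoint_inner_right,
      inner_self_eq_norm_sq_to_K, inner_self_eq_norm_sq_to_K]
    push_cast
    rfl
  have h2 : ‖T.adjoint x‖ ≤ ‖x‖ := by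
    simpa using T.adjoint.le_of_opNorm_le (c := 1) (by rwa [LinearIsometryEquiv.norm_map]) x
  rw [h1]
  refine ⟨by rw [RCLike.re_to_complex, Complex.ofReal_re], ?_⟩
  simp only [RCLike.re_to_complex, Complex.ofReal_re, sub_nonneg]
  gcongr

/-- The intertwining relation `(1 - T T*) T = T (1 - T* T)`. It places `(1 - T* T) h` in the
overlapping space and exhibits `D (T h)` as a preimage under `D`, the square root. -/
theorem apply_one_sub {T : H →L[ℂ] K} (hT : ‖T‖ ≤ 1) (h : H) :
    CFC.sqrt (1 - T ∘L T.adjoint) (CFC.sqrt (1 - T ∘L T.adjoint) (T h)) =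
      T (h - T.adjoint (T h)) := by
  have h1 := CFC.sqrt_mul_sqrt_self (1 - T ∘L T.adjoint) (one_sub_comp_adjoint_nonneg hT)
  have h2 := congrArg (fun A : K →L[ℂ] K => A (T h)) h1
  simpa using h2

/-- The element `(1 - T* T) h` of the overlapping space of a contraction `T`. -/
noncomputable def defect {T : H →L[ℂ] K} (hT : ‖T‖ ≤ 1) (h : H) : OverlappingSpace T :=
  ⟨h - T.adjoint (T h), _, apply_one_sub hT h⟩

/-- The elements `(1 - T* T) h` represent the functionals of the ambient space. -/
theorem inner_defect {T : H →L[ℂ] K} (hT : ‖T‖ ≤ 1) (h : H) (f : OverlappingSpace T) :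
    ⟪defect hT h, f⟫_ℂ = ⟪h, f.val⟫_ℂ := by
  set D := CFC.sqrt (1 - T ∘L T.adjoint) with hD
  have hDsa : D.adjoint = D := (CFC.sqrt_nonneg (1 - T ∘L T.adjoint)).isSelfAdjoint
  have himage : (defect hT h).image = PullbackSpace.mk D (D (T h)) :=
    Subtype.ext (apply_one_sub hT h).symm
  -- The projection in `lift` drops out against a vector of `(ker D)ᗮ`; then `D` moves across by
  -- self-adjointness. The result cancels the term `⟪T h, T f⟫` coming from `⟪h - T* T h, f⟫`.
  have h1 : ⟪PullbackSpace.lift D (PullbackSpace.mk D (D (T h))),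
      PullbackSpace.lift D f.image⟫_ℂ = ⟪T h, T f.val⟫_ℂ := by
    rw [PullbackSpace.lift_mk, Submodule.inner_starProjection_left_eq_right,
      Submodule.starProjection_eq_self_iff.2 (PullbackSpace.lift_mem D f.image)]
    nth_rw 1 [← hDsa]
    rw [ContinuousLinearMap.adjoint_inner_left, PullbackSpace.apply_lift]
    rfl
  rw [inner_eq, himage, h1, show (defect hT h).val = h - T.adjoint (T h) from rfl, inner_sub_left,
    ContinuousLinearMap.adjoint_inner_left]
  ring

/-- The inclusion of the overlapping space in the ambient space. -/
noncomputable def valCLM : OverlappingSpace T →L[ℂ] H :=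
  LinearMap.mkContinuous { toFun := val, map_add' := fun _ _ => rfl, map_smul' := fun _ _ => rfl }
    1 fun f => by
      rw [one_mul]
      refine le_of_sq_le_sq ?_ (norm_nonneg _)
      rw [norm_sq]
      exact le_add_of_nonneg_left (sq_nonneg _)

end OverlappingSpace
end

/-! ### Szegő kernels and point evaluations on the Hardy space -/

namespace HardySpace
variable {U : Type*} [NormedAddCommGroup U] [InnerProductSpace ℂ U] [CompleteSpace U]

/-- The Szegő kernel function `ζ ↦ (1 - ζ z̄)⁻¹ u`. -/
noncomputable def szego (z : Complex.UnitDisc) (u : U) : HardySpace U :=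
  ⟨fun n => conj (z : ℂ) ^ n • u, by
    refine memℓp_gen ?_
    have hz : ‖(z : ℂ)‖ ^ 2 < 1 := by
      have := z.norm_lt_one
      nlinarith [norm_nonneg (z : ℂ)]
    refine ((summable_geometric_of_lt_one (sq_nonneg _) hz).mul_right (‖u‖ ^ 2)).congr fun n => ?_
    simp [norm_smul, mul_pow, ← pow_mul, mul_comm]⟩

theorem inner_szego (z : Complex.UnitDisc) (u : U) (f : HardySpace U) :
    ⟪szego z u, f⟫_ℂ = ⟪u, f.eval z⟫_ℂ := by
  have h1 := (innerSL ℂ u).map_tsum (summable_hardy f z).of_norm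
  rw [lp.inner_eq_tsum, eval]
  refine Eq.trans (tsum_congr fun n => ?_) h1.symm
  change ⟪conj (z : ℂ) ^ n • u, f n⟫_ℂ = _
  simp [mul_comm]

theorem tsum_szego (w : Complex.UnitDisc) (u : U) {z : ℂ} (hz : ‖z‖ < 1) :
    ∑' n, z ^ n • szego w u n = (1 - conj (w : ℂ) * z)⁻¹ • u := by
  have h1 : ‖conj (w : ℂ) * z‖ < 1 := by
    rw [norm_mul, RCLike.norm_conj]
    exact mul_lt_one_of_nonneg_of_lt_one_left (norm_nonneg _) w.norm_lt_one hz.le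
  have h2 := (hasSum_geometric_of_norm_lt_one h1).smul_const u
  rw [← h2.tsum_eq]
  refine tsum_congr fun n => ?_
  change z ^ n • conj (w : ℂ) ^ n • u = _
  rw [smul_smul, mul_pow, mul_comm]

/-- Evaluation at a point of the disk. -/
noncomputable def evalCLM (z : Complex.UnitDisc) : HardySpace U →L[ℂ] U :=
  LinearMap.mkContinuous
    { toFun := fun f => f.eval z
      map_add' := fun f g => by
        simp only [eval, lp.coeFn_add, Pi.add_apply, smul_add]
        exact (summable_hardy f z).of_norm.tsum_add (summable_hardy g z).of_norm
      map_smul' := fun c f => by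
        simp only [eval, lp.coeFn_smul, Pi.smul_apply, RingHom.id_apply]
        rw [← (summable_hardy f z).of_norm.tsum_const_smul]
        exact tsum_congr fun n => smul_comm _ _ _ }
    (1 - ‖(z : ℂ)‖)⁻¹ fun f => by
      refine tsum_of_norm_bounded
        ((hasSum_geometric_of_lt_one (norm_nonneg _) z.norm_lt_one).mul_right ‖f‖) fun n => ?_
      rw [norm_smul, norm_pow]
      gcongr
      exact lp.norm_apply_le_norm (by norm_num) f n

/-- An element of `H²` is determined by its values on the disk. -/
theorem eq_zero_of_eval_eq_zero {f : HardySpace U} (hf : ∀ z, f.eval z = 0) : f = 0 := by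
  ext m
  refine ext_inner_left ℂ fun u => ?_
  -- The Taylor coefficients are recovered from the values on one circle inside the disk; the radius
  -- `1/2` is arbitrary.
  have h1 := circleAverage_tsum_mul_conj_pow (q := fun n => ⟪u, f n⟫_ℂ) (A := ‖u‖ * ‖f‖)
    (fun n => (norm_inner_le_norm _ _).trans
      (by gcongr; exact lp.norm_apply_le_norm (by norm_num) f n))
    (r := 1 / 2) (by norm_num) (by norm_num) m
  have h2 : Set.EqOn (fun z : ℂ => (∑' n, z ^ n • ⟪u, f n⟫_ℂ) * conj z ^ m) (fun _ => 0)
      (sphere 0 |1 / 2|) := by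
    intro z hz
    have hz1 : ‖z‖ < 1 := by
      rw [mem_sphere_zero_iff_norm.1 hz, abs_of_pos] <;> norm_num
    have h3 := (innerSL ℂ u).map_tsum (summable_hardy f (Complex.UnitDisc.mk z hz1)).of_norm
    have h4 : ∑' n, z ^ n • f n = 0 := hf (Complex.UnitDisc.mk z hz1)
    simp only [Complex.UnitDisc.coe_mk, innerSL_apply_apply, inner_smul_right, h4,
      inner_zero_right] at h3
    simp only [smul_eq_mul, ← h3, zero_mul]
  rw [Real.circleAverage_congr_sphere h2, Real.circleAverage_const] at h1
  have h3 : (((1 / 2 : ℝ) : ℂ)) ^ (2 * m) ≠ 0 := pow_ne_zero _ (by norm_num)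
  rw [lp.coeFn_zero, Pi.zero_apply, inner_zero_right]
  exact (mul_eq_zero.1 h1.symm).resolve_right h3

end HardySpace

/-! ### The reproducing kernel in terms of the Toeplitz operator -/

namespace OverlappingSpace
variable {U Y : Type*} [NormedAddCommGroup U] [InnerProductSpace ℂ U] [CompleteSpace U]
  [NormedAddCommGroup Y] [InnerProductSpace ℂ Y] [CompleteSpace Y]

/-- The overlapping space of an operator between Hardy spaces is a reproducing kernel Hilbert space
of functions on the disk. -/
@[reducible] noncomputable def rkhs (T : HardySpace U →L[ℂ] HardySpace Y) :
    RKHS ℂ (OverlappingSpace T) Complex.UnitDisc U where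
  coeCLM := ContinuousLinearMap.pi fun z => HardySpace.evalCLM z ∘L valCLM T
  coeCLM_injective := by
    refine (injective_iff_map_eq_zero _).2 fun f hf => Subtype.ext ?_
    exact HardySpace.eq_zero_of_eval_eq_zero fun z => congrFun hf z

theorem rkhs_apply (T : HardySpace U →L[ℂ] HardySpace Y) (f : OverlappingSpace T)
    (z : Complex.UnitDisc) : letI := rkhs T; f z = HardySpace.eval f.val z := rfl

/-- The kernel function at `w` in the direction `u` is `(1 - T* T)` applied to the Szegő function,
because both represent the functional `f ↦ ⟪u, f w⟫`. -/
theorem inner_kernel {T : HardySpace U →L[ℂ] HardySpace Y} (hT : ‖T‖ ≤ 1)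
    (z w : Complex.UnitDisc) (u v : U) :
    letI := rkhs T
    ⟪v, RKHS.kernel (OverlappingSpace T) z w u⟫_ℂ =
      ⟪HardySpace.szego z v, HardySpace.szego w u⟫_ℂ -
        ⟪T (HardySpace.szego z v), T (HardySpace.szego w u)⟫_ℂ := by
  let := rkhs T
  have h1 : RKHS.kerFun (OverlappingSpace T) w u = defect hT (HardySpace.szego w u) :=
    ext_inner_right ℂ fun f => by
      rw [RKHS.kerFun_inner, inner_defect, HardySpace.inner_szego, rkhs_apply]
  change ⟪v, RKHS.kernel (OverlappingSpace T) z w u⟫_ℂ = _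
  rw [← RKHS.kerFun_apply, h1, rkhs_apply, ← HardySpace.inner_szego]
  change ⟪_, HardySpace.szego w u - T.adjoint (T (HardySpace.szego w u))⟫_ℂ = _
  rw [inner_sub_right, ContinuousLinearMap.adjoint_inner_right]

end OverlappingSpace

/-! ### The boundary defect and its Herglotz integral -/

section
variable {U Y : Type*} [NormedAddCommGroup U] [InnerProductSpace ℂ U] [CompleteSpace U]
  [NormedAddCommGroup Y] [InnerProductSpace ℂ Y] [CompleteSpace Y]

theorem one_sub_conj_mul_ne_zero (w : Complex.UnitDisc) {z : ℂ} (hz : ‖z‖ ≤ 1) :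
    1 - conj (w : ℂ) * z ≠ 0 := by
  intro h
  have h1 : ‖conj (w : ℂ) * z‖ < 1 := by
    rw [norm_mul, RCLike.norm_conj]
    exact mul_lt_one_of_nonneg_of_lt_one_left (norm_nonneg _) w.norm_lt_one hz
  rw [← sub_eq_zero.1 h, norm_one] at h1
  exact lt_irrefl _ h1

theorem norm_inv_one_sub_conj_mul_le (w : Complex.UnitDisc) {z : ℂ} (hz : ‖z‖ ≤ 1) :
    ‖(1 - conj (w : ℂ) * z)⁻¹‖ ≤ (1 - ‖(w : ℂ)‖)⁻¹ := by
  rw [norm_inv]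
  refine inv_anti₀ (sub_pos.2 w.norm_lt_one) ?_
  refine le_trans ?_ (norm_sub_norm_le _ _)
  rw [norm_one, norm_mul, RCLike.norm_conj]
  have := mul_le_of_le_one_right (norm_nonneg (w : ℂ)) hz
  linarith

theorem tsum_toeplitz_szego {S : ℂ → U →L[ℂ] Y} (hS : IsSchur S) (w : Complex.UnitDisc) (u : U)
    {z : ℂ} (hz : ‖z‖ < 1) : ∑' n, z ^ n • toeplitz S hS (HardySpace.szego w u) n =
      (1 - conj (w : ℂ) * z)⁻¹ • S z u := by
  have h1 := eval_toeplitz hS (HardySpace.szego w u) (Complex.UnitDisc.mk z hz)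
  have h2 : (HardySpace.szego w u).eval (Complex.UnitDisc.mk z hz) =
      (1 - conj (w : ℂ) * z)⁻¹ • u := HardySpace.tsum_szego w u hz
  rw [h2, map_smul] at h1
  exact h1

/-- Multiplying by a Szegő kernel does not affect weak boundary values. -/
theorem hasWeakBoundaryValues_szego_smul {E : Type*} [NormedAddCommGroup E]
    [InnerProductSpace ℂ E] {F G b : ℂ → E} (w : Complex.UnitDisc)
    (hF : ∀ᵐ t : ℝ, ∀ y : E, Tendsto (fun r : ℝ => ⟪y, F (circleMap 0 r t)⟫_ℂ) (𝓝[<] 1)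
      (𝓝 ⟪y, b (circleMap 0 1 t)⟫_ℂ))
    (hG : ∀ z : ℂ, ‖z‖ < 1 → G z = (1 - conj (w : ℂ) * z)⁻¹ • F z) :
    HasWeakBoundaryValues G fun ζ => (1 - conj (w : ℂ) * ζ)⁻¹ • b ζ := by
  filter_upwards [hF] with t ht y
  have h1 : Tendsto (fun r : ℝ => (1 - conj (w : ℂ) * circleMap 0 r t)⁻¹) (𝓝[<] 1)
      (𝓝 (1 - conj (w : ℂ) * circleMap 0 1 t)⁻¹) := by
    have h2 : Continuous fun r : ℝ => 1 - conj (w : ℂ) * circleMap 0 r t := by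
      simp only [circleMap]; fun_prop
    exact ((h2.tendsto 1).inv₀ (one_sub_conj_mul_ne_zero w (by simp))).mono_left
      nhdsWithin_le_nhds
  simp only [inner_smul_right]
  refine (h1.mul (ht y)).congr' ?_
  filter_upwards [eventually_norm_circleMap_lt_one t] with r hr
  rw [hG _ (mem_ball_zero_iff.1 hr), inner_smul_right]

theorem circleAverage_inner_szego [TopologicalSpace.SeparableSpace U] (z w : Complex.UnitDisc)
    (u v : U) :
    CircleIntegrable (fun ζ : ℂ => ⟪(1 - conj (z : ℂ) * ζ)⁻¹ • v,
      (1 - conj (w : ℂ) * ζ)⁻¹ • u⟫_ℂ) 0 1 ∧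
    Real.circleAverage (fun ζ : ℂ => ⟪(1 - conj (z : ℂ) * ζ)⁻¹ • v,
      (1 - conj (w : ℂ) * ζ)⁻¹ • u⟫_ℂ) 0 1 =
        ⟪HardySpace.szego z v, HardySpace.szego w u⟫_ℂ := by
  have hbd : ∀ (w : Complex.UnitDisc) (u : U), ∀ x ∈ ball (0 : ℂ) 1,
      ‖∑' n, x ^ n • HardySpace.szego w u n‖ ≤ (1 - ‖(w : ℂ)‖)⁻¹ * ‖u‖ := by
    intro w u x hx
    have hx1 := mem_ball_zero_iff.1 hx
    rw [HardySpace.tsum_szego w u hx1, norm_smul]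
    gcongr
    exact norm_inv_one_sub_conj_mul_le w hx1.le
  exact circleAverage_inner_boundary _ _ (fun x hx => (hbd z v x hx).trans (le_max_left _ _))
    (fun x hx => (hbd w u x hx).trans (le_max_right _ _))
    (hasWeakBoundaryValues_szego_smul (F := fun _ => v) (b := fun _ => v) z
      (.of_forall fun _ _ => tendsto_const_nhds) fun x hx => HardySpace.tsum_szego z v hx)
    (hasWeakBoundaryValues_szego_smul (F := fun _ => u) (b := fun _ => u) w
      (.of_forall fun _ _ => tendsto_const_nhds) fun x hx => HardySpace.tsum_szego w u hx)

/-- Multiplying a Szegő function by `S` gives a bounded function with weak boundary values `(1 -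
w̄ζ)⁻¹ B(ζ) u`, so Parseval's identity applies. -/
theorem circleAverage_inner_toeplitz_szego [TopologicalSpace.SeparableSpace Y]
    {S B : ℂ → U →L[ℂ] Y} (hS : IsSchur S) (hB : IsBoundaryFunction S B)
    (z w : Complex.UnitDisc) (u v : U) :
    CircleIntegrable (fun ζ : ℂ => ⟪(1 - conj (z : ℂ) * ζ)⁻¹ • B ζ v,
      (1 - conj (w : ℂ) * ζ)⁻¹ • B ζ u⟫_ℂ) 0 1 ∧
    Real.circleAverage (fun ζ : ℂ => ⟪(1 - conj (z : ℂ) * ζ)⁻¹ • B ζ v,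
      (1 - conj (w : ℂ) * ζ)⁻¹ • B ζ u⟫_ℂ) 0 1 =
        ⟪toeplitz S hS (HardySpace.szego z v), toeplitz S hS (HardySpace.szego w u)⟫_ℂ := by
  have hbd : ∀ (w : Complex.UnitDisc) (u : U), ∀ x ∈ ball (0 : ℂ) 1,
      ‖∑' n, x ^ n • toeplitz S hS (HardySpace.szego w u) n‖ ≤ (1 - ‖(w : ℂ)‖)⁻¹ * ‖u‖ := by
    intro w u x hx
    have hx1 := mem_ball_zero_iff.1 hx
    rw [tsum_toeplitz_szego hS w u hx1, norm_smul]
    have h1 := sub_pos.2 w.norm_lt_one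
    gcongr
    · exact norm_inv_one_sub_conj_mul_le w hx1.le
    · simpa using (S x).le_of_opNorm_le (hS.norm_le_one x hx) u
  have hbv : ∀ (w : Complex.UnitDisc) (u : U), HasWeakBoundaryValues
      (fun x => ∑' n, x ^ n • toeplitz S hS (HardySpace.szego w u) n)
      fun ζ => (1 - conj (w : ℂ) * ζ)⁻¹ • B ζ u := fun w u =>
    hasWeakBoundaryValues_szego_smul (F := fun x => S x u) (b := fun ζ => B ζ u) w
      (hB.mono fun t ht y => ht.tendsto_radial u y) fun x hx => tsum_toeplitz_szego hS w u hx
  exact circleAverage_inner_boundary _ _ (fun x hx => (hbd z v x hx).trans (le_max_left _ _))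
    (fun x hx => (hbd w u x hx).trans (le_max_right _ _)) (hbv z v) (hbv w u)

/-- The sesquilinear form of the boundary defect `1 - B* B`. -/
noncomputable def defectForm (B : ℂ → U →L[ℂ] Y) (v u : U) (ζ : ℂ) : ℂ :=
  ⟪v, u⟫_ℂ - ⟪B ζ v, B ζ u⟫_ℂ

theorem conj_defectForm (B : ℂ → U →L[ℂ] Y) (v u : U) (ζ : ℂ) :
    conj (defectForm B v u ζ) = defectForm B u v ζ := by
  simp [defectForm]

theorem inner_smul_one_sub (B : ℂ → U →L[ℂ] Y) (v u : U) (c ζ : ℂ) :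
    ⟪v, (c • (1 - (B ζ).adjoint ∘L B ζ)) u⟫_ℂ = c * defectForm B v u ζ := by
  simp [defectForm, ContinuousLinearMap.adjoint_inner_right]

theorem circleAverage_szego_mul_defectForm [TopologicalSpace.SeparableSpace U]
    [TopologicalSpace.SeparableSpace Y]
    {S B : ℂ → U →L[ℂ] Y} (hS : IsSchur S) (hB : IsBoundaryFunction S B)
    (z w : Complex.UnitDisc) (u v : U) :
    CircleIntegrable (fun ζ : ℂ => conj (1 - conj (z : ℂ) * ζ)⁻¹ * (1 - conj (w : ℂ) * ζ)⁻¹ *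
      defectForm B v u ζ) 0 1 ∧
    Real.circleAverage (fun ζ : ℂ => conj (1 - conj (z : ℂ) * ζ)⁻¹ * (1 - conj (w : ℂ) * ζ)⁻¹ *
      defectForm B v u ζ) 0 1 =
      ⟪HardySpace.szego z v, HardySpace.szego w u⟫_ℂ -
        ⟪toeplitz S hS (HardySpace.szego z v), toeplitz S hS (HardySpace.szego w u)⟫_ℂ := by
  obtain ⟨h1, h2⟩ := circleAverage_inner_szego z w u v
  obtain ⟨h3, h4⟩ := circleAverage_inner_toeplitz_szego hS hB z w u v
  have h5 : (fun ζ : ℂ => conj (1 - conj (z : ℂ) * ζ)⁻¹ * (1 - conj (w : ℂ) * ζ)⁻¹ *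
      defectForm B v u ζ) = fun ζ : ℂ => ⟪(1 - conj (z : ℂ) * ζ)⁻¹ • v,
      (1 - conj (w : ℂ) * ζ)⁻¹ • u⟫_ℂ - ⟪(1 - conj (z : ℂ) * ζ)⁻¹ • B ζ v,
      (1 - conj (w : ℂ) * ζ)⁻¹ • B ζ u⟫_ℂ := by
    ext ζ
    simp only [defectForm, inner_smul_left, inner_smul_right]
    ring
  rw [h5, Real.circleAverage_fun_sub h1 h3, h2, h4]
  exact ⟨h1.sub h3, rfl⟩

theorem circleIntegrable_mul_defectForm [TopologicalSpace.SeparableSpace U]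
    [TopologicalSpace.SeparableSpace Y]
    {S B : ℂ → U →L[ℂ] Y} (hS : IsSchur S) (hB : IsBoundaryFunction S B) {h : ℂ → ℂ}
    (hh : ContinuousOn h (sphere 0 1)) (u v : U) :
    CircleIntegrable (fun ζ => h ζ * defectForm B v u ζ) 0 1 := by
  -- At the origin the Szegő kernels are identically one, which leaves integrability of the defect
  -- form itself.
  have h1 := (circleAverage_szego_mul_defectForm hS hB 0 0 u v).1
  simp only [Complex.UnitDisc.coe_zero, map_zero, zero_mul, sub_zero, inv_one, map_one,
    one_mul] at h1
  have h2 : Continuous fun t => h (circleMap 0 1 t) :=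
    hh.comp_continuous (continuous_circleMap 0 1) fun t => circleMap_mem_sphere 0 zero_le_one t
  exact IntervalIntegrable.continuousOn_mul h1 h2.continuousOn

theorem continuousOn_herglotz (z : Complex.UnitDisc) :
    ContinuousOn (fun ζ : ℂ => (ζ + z) / (ζ - z)) (sphere 0 1) := by
  refine ContinuousOn.div (by fun_prop) (by fun_prop) fun ζ hζ h => ?_
  have h1 := z.norm_lt_one
  rw [← sub_eq_zero.1 h, mem_sphere_zero_iff_norm.1 hζ] at h1
  exact lt_irrefl _ h1

/-- The Herglotz integral of the boundary defect exists. -/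
theorem exists_isHerglotzIntegral [TopologicalSpace.SeparableSpace U]
    [TopologicalSpace.SeparableSpace Y]
    {S B : ℂ → U →L[ℂ] Y} (hS : IsSchur S) (hB : IsBoundaryFunction S B) :
    ∃ φ : Complex.UnitDisc → U →L[ℂ] U, IsHerglotzIntegral B φ := by
  suffices h : ∀ z : Complex.UnitDisc, ∃ A : U →L[ℂ] U, HasWeakCircleAverage
      (fun ζ => ((ζ + z) / (ζ - z)) • (1 - (B ζ).adjoint ∘L B ζ)) A by
    choose φ hφ using h
    exact ⟨φ, hφ⟩
  intro z
  have hint := fun u v => circleIntegrable_mul_defectForm hS hB (continuousOn_herglotz z) u v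
  obtain ⟨C, hC⟩ := (isCompact_sphere (0 : ℂ) 1).exists_bound_of_continuousOn
    (continuousOn_herglotz z)
  have hC0 : 0 ≤ C := (norm_nonneg _).trans (hC 1 (by simp))
  -- `C` bounds the Herglotz kernel on the circle, and the defect form is at most `2 ‖v‖ ‖u‖` almost
  -- everywhere because the boundary values are contractions.
  obtain ⟨A, hA⟩ := exists_clm_inner_eq (U := U) (Y := U) (C := C * 2)
    (φ := fun v u => Real.circleAverage (fun ζ => (ζ + z) / (ζ - z) * defectForm B v u ζ) 0 1)
    (by positivity)
    (fun v v' u => by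
      rw [← Real.circleAverage_fun_add (hint u v) (hint u v')]
      congr 1; ext ζ
      simp only [defectForm, map_add, inner_add_left]; ring)
    (fun c v u => by
      rw [← smul_eq_mul, ← Real.circleAverage_fun_smul]
      congr 1; ext ζ
      simp only [defectForm, map_smul, inner_smul_left, smul_eq_mul]; ring)
    (fun v u u' => by
      rw [← Real.circleAverage_fun_add (hint u v) (hint u' v)]
      congr 1; ext ζ
      simp only [defectForm, map_add, inner_add_right]; ring)
    (fun c v u => by
      rw [← smul_eq_mul, ← Real.circleAverage_fun_smul]
      congr 1; ext ζ
      simp only [defectForm, map_smul, inner_smul_right, smul_eq_mul]; ring)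
    (fun v u => by
      have h1 := intervalIntegral.norm_integral_le_of_norm_le_const_ae (a := 0)
        (b := 2 * Real.pi) (f := fun t : ℝ => (circleMap 0 1 t + z) / (circleMap 0 1 t - z) *
          defectForm B v u (circleMap 0 1 t)) (C := C * (2 * (‖v‖ * ‖u‖))) (by
          filter_upwards [hB] with t ht _
          have hB1 := ht.norm_le_one hS
          rw [norm_mul]
          gcongr
          · exact hC _ (circleMap_mem_sphere 0 zero_le_one t)
          · refine (norm_sub_le _ _).trans ?_
            have h2 := norm_inner_le_norm (𝕜 := ℂ) v u
            have h3 := norm_inner_le_norm (𝕜 := ℂ) (B (circleMap 0 1 t) v) (B (circleMap 0 1 t) u)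
            have h4 : ‖B (circleMap 0 1 t) v‖ * ‖B (circleMap 0 1 t) u‖ ≤ ‖v‖ * ‖u‖ := by
              gcongr
              · simpa using (B (circleMap 0 1 t)).le_of_opNorm_le hB1 v
              · simpa using (B (circleMap 0 1 t)).le_of_opNorm_le hB1 u
            linarith)
      rw [Real.circleAverage, norm_smul, norm_inv, Real.norm_of_nonneg Real.two_pi_pos.le,
        inv_mul_le_iff₀ Real.two_pi_pos]
      refine h1.trans (le_of_eq ?_)
      rw [sub_zero, abs_of_pos Real.two_pi_pos]
      ring)
  refine ⟨A, fun u v => ?_⟩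
  simp only [inner_smul_one_sub]
  exact ⟨hint u v, (hA v u).symm⟩

/-- With `a = z ζ̄` and `b = w̄ ζ`, the identity is `(1 + a)/(1 - a) + (1 + b)/(1 - b) = 2 (1 - a
b)/((1 - a)(1 - b))`; on the circle `a b = z w̄` no longer depends on `ζ`. -/
theorem szego_mul_eq_herglotz (z w : Complex.UnitDisc) {ζ : ℂ} (hζ : ‖ζ‖ = 1) :
    conj (1 - conj (z : ℂ) * ζ)⁻¹ * (1 - conj (w : ℂ) * ζ)⁻¹ =
      ((1 : ℂ) / 2) * (1 / (1 - (z : ℂ) * conj (w : ℂ))) *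
        ((ζ + z) / (ζ - z) + conj ((ζ + w) / (ζ - w))) := by
  have hζ0 : ζ ≠ 0 := by rintro rfl; simp at hζ
  have hconj : conj ζ = ζ⁻¹ := by
    refine eq_inv_of_mul_eq_one_right ?_
    rw [Complex.mul_conj, Complex.normSq_eq_norm_sq, hζ]
    simp
  have h1 := one_sub_conj_mul_ne_zero w hζ.le
  have h2 : (1 : ℂ) - z * conj (w : ℂ) ≠ 0 := by
    rw [mul_comm]
    exact one_sub_conj_mul_ne_zero w z.norm_lt_one.le
  have h3 : ζ - z ≠ 0 := by
    intro h
    have := z.norm_lt_one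
    rw [← sub_eq_zero.1 h, hζ] at this
    exact lt_irrefl _ this
  have h4 : conj (1 - conj (z : ℂ) * ζ)⁻¹ = ζ / (ζ - z) := by
    rw [map_inv₀, map_sub, map_mul, Complex.conj_conj, map_one, hconj, ← div_eq_mul_inv,
      one_sub_div hζ0, inv_div]
  have h5 : conj ((ζ + w) / (ζ - w)) = (1 + conj (w : ℂ) * ζ) / (1 - conj (w : ℂ) * ζ) := by
    rw [map_div₀, map_add, map_sub, hconj, ← mul_div_mul_right _ _ hζ0, add_mul, sub_mul,
      inv_mul_cancel₀ hζ0]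
  rw [h4, h5, mul_comm _ ζ]
  rw [mul_comm _ ζ] at h1
  field_simp
  ring

end
end DeBrangesRovnyak

/-! ### The kernel formula -/

open DeBrangesRovnyak
theorem theorem3p12 {U Y : Type*}
    [NormedAddCommGroup U] [InnerProductSpace ℂ U] [CompleteSpace U]
    [TopologicalSpace.SeparableSpace U]
    [NormedAddCommGroup Y] [InnerProductSpace ℂ Y] [CompleteSpace Y]
    [TopologicalSpace.SeparableSpace Y]
    (S : ℂ → U →L[ℂ] Y) (hS : IsSchur S) :
    (∃ B : ℂ → U →L[ℂ] Y, IsBoundaryFunction S B) ∧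
    ∃ (_ : CompleteSpace (OverlappingSpace (toeplitz S hS)))
      (_ : RKHS ℂ (OverlappingSpace (toeplitz S hS)) Complex.UnitDisc U),
      (∀ (f : OverlappingSpace (toeplitz S hS)) (z : Complex.UnitDisc),
        f z = HardySpace.eval f.val z) ∧
      ∀ B : ℂ → U →L[ℂ] Y, IsBoundaryFunction S B →
        ∃ φ : Complex.UnitDisc → U →L[ℂ] U, IsHerglotzIntegral B φ ∧
          ∀ z w : Complex.UnitDisc,
            RKHS.kernel (OverlappingSpace (toeplitz S hS)) z w =
              (((1 : ℂ) / 2) * (1 / (1 - (z : ℂ) * conj (w : ℂ)))) •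
                (φ z + (φ w).adjoint) := by
  refine ⟨hS.exists_isBoundaryFunction, inferInstance, OverlappingSpace.rkhs (toeplitz S hS),
    OverlappingSpace.rkhs_apply (toeplitz S hS), fun B hB => ?_⟩
  obtain ⟨φ, hφ⟩ := exists_isHerglotzIntegral hS hB
  refine ⟨φ, hφ, fun z w => ?_⟩
  let := OverlappingSpace.rkhs (toeplitz S hS)
  ext u
  refine ext_inner_left ℂ fun v => ?_
  have hint := fun (z : Complex.UnitDisc) u v =>
    circleIntegrable_mul_defectForm hS hB (continuousOn_herglotz z) u v
  have hφ' : ∀ (z : Complex.UnitDisc) (u v : U), ⟪v, φ z u⟫_ℂ =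
      Real.circleAverage (fun ζ => (ζ + z) / (ζ - z) * defectForm B v u ζ) 0 1 := by
    intro z u v
    rw [← (hφ z u v).2]
    simp only [inner_smul_one_sub]
  -- The defect form is Hermitian, so taking the adjoint of `φ w` only conjugates the scalar
  -- Herglotz kernel.
  have hadj : ⟪v, (φ w).adjoint u⟫_ℂ = Real.circleAverage
      (fun ζ => conj ((ζ + w) / (ζ - w)) * defectForm B v u ζ) 0 1 := by
    rw [ContinuousLinearMap.adjoint_inner_right, ← inner_conj_symm, hφ', ← circleAverage_conj]
    simp only [map_mul, conj_defectForm]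
  have hint' : CircleIntegrable
      (fun ζ => conj ((ζ + w) / (ζ - w)) * defectForm B v u ζ) 0 1 := circleIntegrable_mul_defectForm hS hB
    (Complex.continuous_conj.comp_continuousOn (continuousOn_herglotz w)) u v
  rw [OverlappingSpace.inner_kernel (norm_toeplitz_le hS),
    ← (circleAverage_szego_mul_defectForm hS hB z w u v).2, smul_apply, add_apply,
    inner_smul_right, inner_add_right, hφ', hadj,
    ← Real.circleAverage_fun_add (hint z u v) hint', ← smul_eq_mul,
    ← Real.circleAverage_fun_smul]
  -- Everything is now one integral against the defect form; the integrands are compared only on the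
  -- circle, where the Szegő–Herglotz identity holds.
  refine Real.circleAverage_congr_sphere fun ζ hζ => ?_
  rw [abs_one, Metric.mem_sphere, dist_zero_right] at hζ
  simp only [szego_mul_eq_herglotz z w hζ, smul_eq_mul]
  ring
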